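/- **Notation.** For $n\ge 0$ let $E_n=\{t\in\mathbb R^n: t_j\ge 0,\ \sum_j t_j\le 1\}$, $t_0=1-t_1-\dots-t_n$, and for $b=(b_0,\dots,b_n)$ with positive entries let $\phi_b(t)=\Gamma(b_0+\dots+b_n)\prod_{i=0}^n\Gamma(b_i)^{-1}t_i^{b_i-1}$ be the Dirichlet density on $E_n$. For a real $s\times(n+1)$ matrix $X$ with columns $x^0,\dots,x^n$ let $[X]\subset\mathbb R^s$ be the convex hull of the columns and $Xt=\sum_{i=0}^n t_ix^i$. If $\mathrm{vol}_s([X])>0$ and $d\in\mathbb R_{>0}^{n+1}$, the Dirichlet spline $M(\cdot|d;X)$ is the locally integrable function (unique up to null sets) with $\int_{\mathbb R^s}f(y)M(y|d;X)\,dy=\int_{E_n}f(Xt)\phi_d(t)\,dt$ for all continuous compactly supported $f$. Its moments are $m_\beta(d;X)=\int_{\mathbb R^s}y^\beta M(y|d;X)\,dy$, $\beta\in\mathbb R^s$, where $y^\beta=y_1^{\beta_1}\cdots y_s^{\beta_s}$. For $a\in\mathbb R$ and $z\in\mathbb R^{n+1}$ with positive entries, $R_{-a}(b;z)$ is the Dirichlet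 average $\int_{E_n}\bigl(\sum_{i=0}^n t_iz_i\bigr)^{-a}\phi_b(t)\,dt$ if all $b_i>0$; for other $b$ with $c=b_0+\dots+b_n\ne 0,-1,-2,\dots$ it is defined by analytic continuation in $b$ (over $\{b\in\mathbb C^{n+1}: c\neq 0,-1,-2,\dots\}$). With $(a,0)=1$ and $(a,l)=a(a+1)\cdots(a+l-1)$, Appell's function is $$F_4(\alpha,\beta;\gamma,\delta;\xi,\eta)=\sum_{i,j\ge0}\frac{(\alpha,i+j)(\beta,i+j)}{(\gamma,i)(\delta,j)\,i!\,j!}\,\xi^i\eta^j\qquad(\gamma,\delta\ne0,-1,-2,\dots,\ |\xi|^{1/2}+|\eta|^{1/2}<1),$$ continued real-analytically to the set of all $(\xi,\eta)=(x_1(1-x_2),x_2(1-x_1))$ with $(x_1,x_2)\in\Lambda=\{(x_1,x_2)\in\mathbb R^2: x_1<1,\ x_2<1,\ x_1+x_2<1\}$. **Statement.** Let $(x_1,x_2)\in\Lambda$ be such that $\mathrm{vol}_2([X])>0$, where $$X=\begin{pmatrix}(1-x_1)(1-x_2)&1-x_1-x_2&1-x_1\\ 1-x_2&1-x_2&1\end{pmatrix}.$$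 (i) Let $\alpha,\beta,\gamma,\delta\in\mathbb R$ with $\gamma\ne0,-1,-2,\dots$, let $d=(\gamma+\delta-\alpha-1,\ \alpha+\beta-\gamma-\delta+1,\ \delta-\beta)$ have positive entries (so that $\delta>0$), and let $b=(\beta,\gamma-\beta)\in\mathbb R^2$. Then the integral below converges absolutely and $$F_4(\alpha,\beta;\gamma,\delta;x_1(1-x_2),x_2(1-x_1))=\int_{[X]}M(y|d;X)\,R_{-\alpha}(b;y)\,dy .$$ (ii) Let $\alpha,\beta,\delta\in\mathbb R$ with $\alpha\ne0,-1,-2,\dots$, let $d=(\delta-1,\ \beta-\delta+1,\ \delta-\beta)$ have positive entries, and let $b=(\beta,\alpha-\beta)\in\mathbb R^2$. Then the integral defining $m_{-b}(d;X)$ converges absolutely and $$F_4(\alpha,\beta;\alpha,\delta;x_1(1-x_2),x_2(1-x_1))=m_{-b}(d;X).$$ -/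

import Mathlib

open MeasureTheory
open scoped Matrix

noncomputable section

namespace DirichletSpline

/-- The standard simplex `E_n = {t ∈ ℝⁿ : t_j ≥ 0, t_1 + ⋯ + t_n ≤ 1}`. -/
def simplexE (n : ℕ) : Set (Fin n → ℝ) :=
  {t | (∀ j, 0 ≤ t j) ∧ ∑ j, t j ≤ 1}

/-- The vector `(t_0, t_1, …, t_n)` with `t_0 = 1 - t_1 - ⋯ - t_n`. -/
def bary {n : ℕ} (t : Fin n → ℝ) : Fin (n + 1) → ℝ :=
  Fin.cons (1 - ∑ j, t j) t

/-- The Dirichlet density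
`φ_b(t) = Γ(b_0 + ⋯ + b_n) ∏ᵢ Γ(b_i)⁻¹ t_i ^ (b_i - 1)` on `E_n`. -/
def dirichletDensity {n : ℕ} (b : Fin (n + 1) → ℝ) (t : Fin n → ℝ) : ℝ :=
  Real.Gamma (∑ i, b i) * ∏ i, ((Real.Gamma (b i))⁻¹ * bary t i ^ (b i - 1))

/-- The convex hull `[X]` of the columns `x⁰, …, xⁿ` of an `s × (n+1)` matrix `X`. -/
def hull {s n : ℕ} (X : Matrix (Fin s) (Fin (n + 1)) ℝ) : Set (Fin s → ℝ) :=
  convexHull ℝ (Set.range fun j => fun i => X i j)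

/-- `M` is (a version of) the multivariate Dirichlet spline `M(·|b;X)`: it is locally integrable
and `∫ f(x) M(x) dx = ∫_{E_n} f(Xt) φ_b(t) dt` for all continuous `f` with compact support,
where `Xt = ∑ᵢ t_i xⁱ`. These requirements determine `M` up to a Lebesgue null set. -/
def IsDirichletSpline {s n : ℕ} (b : Fin (n + 1) → ℝ) (X : Matrix (Fin s) (Fin (n + 1)) ℝ)
    (M : (Fin s → ℝ) → ℝ) : Prop :=
  LocallyIntegrable M ∧
    ∀ f : (Fin s → ℝ) → ℝ, Continuous f → HasCompactSupport f →
      ∫ x, f x * M x = ∫ t in simplexE n, f (X *ᵥ bary t) * dirichletDensity b t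

/-- The multivariate Dirichlet spline `M(·|b;X)`. -/
def spline {s n : ℕ} (b : Fin (n + 1) → ℝ) (X : Matrix (Fin s) (Fin (n + 1)) ℝ) :
    (Fin s → ℝ) → ℝ :=
  Classical.epsilon (IsDirichletSpline b X)

/-- The integrand `x ^ β M(x|b;X)` of the moment of the Dirichlet spline, for real exponents
`β ∈ ℝˢ`, with `x ^ β = x_1 ^ β_1 ⋯ x_s ^ β_s`. -/
def momentIntegrand {s n : ℕ} (β : Fin s → ℝ) (b : Fin (n + 1) → ℝ)
    (X : Matrix (Fin s) (Fin (n + 1)) ℝ) (x : Fin s → ℝ) : ℝ :=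
  (∏ i, x i ^ β i) * spline b X x

/-- The moment `m_β(b;X) = ∫ x ^ β M(x|b;X) dx`. -/
def moment {s n : ℕ} (β : Fin s → ℝ) (b : Fin (n + 1) → ℝ)
    (X : Matrix (Fin s) (Fin (n + 1)) ℝ) : ℝ :=
  ∫ x, momentIntegrand β b X x

/-- The single Dirichlet average `H(b;z) = ∫_{E_n} h(∑ᵢ t_i z_i) φ_b(t) dt` for `b` with positive
entries. -/
def dirichletAverage {n : ℕ} (h : ℝ → ℝ) (b z : Fin (n + 1) → ℝ) : ℝ :=
  ∫ t in simplexE n, h (∑ i, bary t i * z i) * dirichletDensity b t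

/-- `G` is the analytic continuation, in the parameters `b`, of the Dirichlet average of
`u ↦ u ^ (-a)` at `z` (with `z_i > 0`): it is holomorphic on the connected open set of all
`b ∈ ℂⁿ⁺¹` with `b_0 + ⋯ + b_n ≠ 0, -1, -2, …`, and it is given by the integral when all the
parameters are real and positive. -/
def IsRContinuation {n : ℕ} (a : ℝ) (z : Fin (n + 1) → ℝ) (G : (Fin (n + 1) → ℂ) → ℂ) : Prop :=
  AnalyticOnNhd ℂ G {b | ∀ m : ℕ, ∑ i, b i ≠ -(m : ℂ)} ∧
    ∀ b : Fin (n + 1) → ℝ, (∀ i, 0 < b i) →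
      G (fun i => (b i : ℂ)) = (dirichletAverage (fun u => u ^ (-a)) b z : ℂ)

/-- `hyperR a b z` is the `R`-hypergeometric function `R_{-a}(b;z)`, the single Dirichlet average
of `u ↦ u ^ (-a)`, for `z` with positive entries and for all real parameters `b` with
`b_0 + ⋯ + b_n ≠ 0, -1, -2, …`. -/
def hyperR {n : ℕ} (a : ℝ) (b z : Fin (n + 1) → ℝ) : ℝ :=
  (Classical.epsilon (IsRContinuation a z) (fun i => (b i : ℂ))).re

/-- The Appell symbol `(a,l) = a (a+1) ⋯ (a+l-1)`. -/
def appellSymbol (a : ℝ) (l : ℕ) : ℝ := ∏ k ∈ Finset.range l, (a + k)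

/-- The general term of the double power series of Appell's function `F_4`. -/
def appellF4Term (α β γ δ X Y : ℝ) (p : ℕ × ℕ) : ℝ :=
  appellSymbol α (p.1 + p.2) * appellSymbol β (p.1 + p.2) /
    (appellSymbol γ p.1 * appellSymbol δ p.2 * (p.1.factorial : ℝ) * (p.2.factorial : ℝ)) *
      X ^ p.1 * Y ^ p.2

/-- The region `Λ = {(x_1,x_2) : x_1 < 1, x_2 < 1, x_1 + x_2 < 1}`. -/
def regionΛ : Set (ℝ × ℝ) := {x | x.1 < 1 ∧ x.2 < 1 ∧ x.1 + x.2 < 1}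

/-- The set of all `(x_1 (1 - x_2), x_2 (1 - x_1))` with `(x_1,x_2) ∈ Λ`. It is connected, contains
the domain `|X|^{1/2} + |Y|^{1/2} < 1` of the `F_4` series, and the map is injective on `Λ`. -/
def domainF4 : Set (ℝ × ℝ) := (fun x => (x.1 * (1 - x.2), x.2 * (1 - x.1))) '' regionΛ

/-- `G` is the analytic continuation of the `F_4` series to `domainF4`. -/
def IsAppellF4 (α β γ δ : ℝ) (G : ℝ × ℝ → ℝ) : Prop :=
  AnalyticOnNhd ℝ G domainF4 ∧
    ∀ X Y : ℝ, √|X| + √|Y| < 1 → HasSum (appellF4Term α β γ δ X Y) (G (X, Y))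

/-- Appell's function `F_4(α,β;γ,δ;X,Y)`: the sum of the double series where
`|X|^{1/2} + |Y|^{1/2} < 1`, continued analytically to `domainF4`. -/
def appellF4 (α β γ δ X Y : ℝ) : ℝ :=
  Classical.epsilon (IsAppellF4 α β γ δ) (X, Y)

/-- The `2 × 3` matrix of knots. -/
def knots (x₁ x₂ : ℝ) : Matrix (Fin 2) (Fin 3) ℝ :=
  !![(1 - x₁) * (1 - x₂), 1 - x₁ - x₂, 1 - x₁;
     1 - x₂, 1 - x₂, 1]

end DirichletSpline

end

/-!
By the change of variables `t ↦ X t`, the integral of `R_{-α}(b; ·)` against the spline is the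
double Dirichlet average `∫ R_{-α}(b; X t) φ_d(t) dt` over the simplex. Near the origin, write
`R_{-α}(β, γ - β; z₀, z₁) = z₁ ^ (-α) ₂F₁(α, β; γ; 1 - z₀ / z₁)`, expand in powers of `x₁`, `x₂`
and integrate term by term, the monomials having explicit Dirichlet moments. The coefficients of the
`F₄` series in `x₁` and `x₂` agree with the result by two applications of the Chu–Vandermonde
identity. On all of `Λ` the double average is real analytic in `(x₁, x₂)`, and the map
`(x₁, x₂) ↦ (x₁ (1 - x₂), x₂ (1 - x₁))` has a real-analytic inverse there, so the double average is
the analytic continuation of the series. The second part is the case `γ = α`, in which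
`R_{-(b₀ + b₁)}(b; z) = z₀ ^ (-b₀) z₁ ^ (-b₁)`.

The analyticity and the continuation of `R` in its parameters rest on the expansion of `R_{-a}` in
powers of `1 - z_i / l`, which converges as soon as `0 < z_i < 2 l` and has explicit coefficients
that are meromorphic in `b`.
-/

noncomputable section

namespace DirichletSpline

open Filter Topology ProbabilityTheory Finset.HasAntidiagonal
open scoped Nat

section RisingFactorial

lemma factorial_add {R : Type*} [CommSemiring R] (m n : ℕ) :
    ((m + n)! : R) = (m + n).choose m * m ! * n ! := by
  rw [← Nat.add_choose_mul_factorial_mul_factorial, Nat.choose_symm_add]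
  push_cast
  rfl

/-- The rising factorial `(a)_n = a (a + 1) ⋯ (a + n - 1)`, as a function of `a` and `n`. -/
def rising {R : Type*} [Semiring R] (a : R) (n : ℕ) : R := (ascPochhammer R n).eval a

@[simp]
lemma rising_zero {R : Type*} [Semiring R] (a : R) : rising a 0 = 1 := by simp [rising]

lemma rising_succ {R : Type*} [Semiring R] (a : R) (n : ℕ) :
    rising a (n + 1) = rising a n * (a + n) := ascPochhammer_succ_eval n a

lemma rising_one_left {R : Type*} [Semiring R] (n : ℕ) : rising (1 : R) n = n ! :=
  ascPochhammer_eval_one R n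

lemma rising_pos {a : ℝ} (ha : 0 < a) (n : ℕ) : 0 < rising a n := ascPochhammer_pos n a ha

lemma appellSymbol_eq_rising (a : ℝ) (n : ℕ) : appellSymbol a n = rising a n := by
  induction n with
  | zero => simp [appellSymbol]
  | succ n ih => rw [rising_succ, ← ih, appellSymbol, Finset.prod_range_succ, appellSymbol]

lemma map_rising {R S : Type*} [Semiring R] [Semiring S] (f : R →+* S) (a : R) (n : ℕ) :
    f (rising a n) = rising (f a) n := by
  rw [rising, rising, ← Polynomial.eval_map_apply, ascPochhammer_map]

variable {R : Type*} [CommRing R] (a b : R)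

lemma rising_add (m n : ℕ) : rising a (m + n) = rising a m * rising (a + m) n := by
  simp [rising, ← ascPochhammer_mul]

lemma rising_neg (n : ℕ) : rising (-a) n = (-1) ^ n * (descPochhammer R n).eval a :=
  ascPochhammer_eval_neg_eq_descPochhammer R a n

lemma rising_neg_natCast (m n : ℕ) : rising (-m : R) n = (-1) ^ n * m.descFactorial n := by
  rw [rising_neg, descPochhammer_eval_eq_descFactorial]

lemma rising_neg_reflect (n : ℕ) : rising (-a) n = (-1) ^ n * rising (a - n + 1) n := by
  rw [rising_neg, descPochhammer_eval_eq_ascPochhammer, rising]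

lemma rising_eq_smeval_descPochhammer (n : ℕ) :
    rising a n = (-1) ^ n * (descPochhammer ℤ n).smeval (-a) := by
  rw [Polynomial.descPochhammer_smeval_eq_ascPochhammer, Polynomial.ascPochhammer_smeval_eq_eval,
    ← descPochhammer_eval_eq_ascPochhammer, ← rising_neg, neg_neg]

lemma sum_choose_mul_rising_mul_rising (n : ℕ) :
    ∑ p ∈ antidiagonal n, (n.choose p.1 : R) * (rising a p.1 * rising b p.2)
      = rising (a + b) n := by
  rw [rising_eq_smeval_descPochhammer, neg_add,
    Ring.descPochhammer_smeval_add n (Commute.all _ _), Finset.mul_sum]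
  refine Finset.sum_congr rfl fun p hp => ?_
  rw [rising_eq_smeval_descPochhammer, rising_eq_smeval_descPochhammer, ← mem_antidiagonal.1 hp,
    pow_add]
  ring

lemma sum_choose_mul_descFactorial_mul_rising (k m : ℕ) :
    ∑ p ∈ antidiagonal k, (k.choose p.1 : R) * ((-1) ^ p.1 * m.descFactorial p.1 *
      rising a (m + p.2)) = rising a k * rising a m := by
  calc
    _ = rising a m * ∑ p ∈ antidiagonal k,
          (k.choose p.1 : R) * (rising (-m : R) p.1 * rising (a + m) p.2) := by
        simp only [rising_add, rising_neg_natCast, Finset.mul_sum]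
        exact Finset.sum_congr rfl fun p _ => by ring
    _ = rising a k * rising a m := by
        rw [sum_choose_mul_rising_mul_rising, neg_add_cancel_comm_assoc, mul_comm]

lemma sum_rising_div_factorial_mul {K : Type*} [Field K] [CharZero K] (a b : K) (n : ℕ) :
    ∑ p ∈ antidiagonal n, rising a p.1 / p.1 ! * (rising b p.2 / p.2 !)
      = rising (a + b) n / n ! := by
  rw [← sum_choose_mul_rising_mul_rising, Finset.sum_div]
  refine Finset.sum_congr rfl fun ⟨i, j⟩ hp => ?_
  obtain rfl := mem_antidiagonal.1 hp
  have : ((i + j).choose i : K) ≠ 0 := by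
    exact_mod_cast (Nat.choose_pos (Nat.le_add_right i j)).ne'
  rw [factorial_add]
  field_simp

end RisingFactorial

section AppellIdentity

lemma sum_antidiagonal_fst_comm {M : Type*} [AddCommMonoid M] (n : ℕ) (f : ℕ → ℕ → ℕ → M) :
    ∑ p ∈ antidiagonal n, ∑ u ∈ antidiagonal p.1, f u.1 u.2 p.2
      = ∑ p ∈ antidiagonal n, ∑ u ∈ antidiagonal p.2, f p.1 u.1 u.2 := by
  rw [Finset.sum_sigma', Finset.sum_sigma']
  refine Finset.sum_nbij' (fun x => ⟨(x.2.1, x.2.2 + x.1.2), (x.2.2, x.1.2)⟩)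
    (fun x => ⟨(x.1.1 + x.2.1, x.2.2), (x.1.1, x.2.1)⟩) ?_ ?_ ?_ ?_ ?_ <;>
  grind [mem_antidiagonal]

variable {R : Type*} [CommRing R]

lemma sum_choose_mul_choose_mul_rising (b : R) {k q l m : ℕ} (h : q + l = m) :
    ∑ u ∈ antidiagonal l, (m.choose (q + u.1) : R) * (q + u.1).choose q *
        (k.descFactorial (q + u.1) * (-1) ^ u.1 * rising b (k + u.2))
      = m.choose q * (k.descFactorial q * (rising b k * rising (b + q) l)) := by
  rcases lt_or_ge k q with hkq | hqk
  · have hzero : ∀ w, k.descFactorial (q + w) = 0 := fun w =>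
      Nat.descFactorial_of_lt (by omega)
    simp [hzero, Nat.descFactorial_of_lt hkq]
  obtain ⟨K, rfl⟩ := Nat.exists_eq_add_of_le hqk
  have hterm : ∀ u : ℕ × ℕ, (m.choose (q + u.1) : R) * (q + u.1).choose q *
        ((q + K).descFactorial (q + u.1) * (-1) ^ u.1 * rising b (q + K + u.2))
      = m.choose q * (q + K).descFactorial q * rising b q *
        (l.choose u.1 * ((-1) ^ u.1 * K.descFactorial u.1 * rising (b + q) (K + u.2))) := by
    intro u
    have hchoose := Nat.choose_mul (n := m) (Nat.le_add_right q u.1)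
    have hdesc := Nat.descFactorial_mul_descFactorial (n := q + K) (Nat.le_add_right q u.1)
    rw [Nat.add_sub_cancel_left, ← h, Nat.add_sub_cancel_left, h] at hchoose
    rw [Nat.add_sub_cancel_left, Nat.add_sub_cancel_left] at hdesc
    rw [← Nat.cast_mul, hchoose, ← hdesc, add_assoc, rising_add b q]
    push_cast
    ring
  rw [Finset.sum_congr rfl fun u _ => hterm u, ← Finset.mul_sum,
    sum_choose_mul_descFactorial_mul_rising, rising_add b q]
  ring

lemma appell_identity (α β g : R) (k m : ℕ) :
    ∑ p ∈ antidiagonal m, (m.choose p.1 : R) * (k.descFactorial p.1 * (-1) ^ p.1 *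
        (rising α (k + p.2) * rising β (k + p.2) * rising (g + (α + ↑(k + p.2))) p.1))
      = ∑ p ∈ antidiagonal m, (m.choose p.1 : R) * (k.descFactorial p.1 * (-1) ^ p.1 *
        (rising α (k + p.2) * rising g p.1 * rising β k * rising (β + p.1) p.2)) := by
  let summand : ℕ → ℕ → ℕ → R := fun q w s =>
    (m.choose (q + w) : R) * (q + w).choose q * (k.descFactorial (q + w) *
      (-1) ^ (q + w) * (rising α (k + s + w) * rising β (k + s) * rising g q))
  calc
    _ = ∑ p ∈ antidiagonal m, ∑ u ∈ antidiagonal p.1, summand u.1 u.2 p.2 := by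
        refine Finset.sum_congr rfl fun p _ => ?_
        rw [← sum_choose_mul_rising_mul_rising, Finset.mul_sum, Finset.mul_sum, Finset.mul_sum]
        refine Finset.sum_congr rfl fun u hu => ?_
        simp only [summand, rising_add α (k + p.2), ← mem_antidiagonal.1 hu]
        ring
    _ = ∑ p ∈ antidiagonal m, ∑ u ∈ antidiagonal p.2, summand p.1 u.1 u.2 :=
        sum_antidiagonal_fst_comm m summand
    _ = _ := by
        refine Finset.sum_congr rfl fun p hp => ?_
        have inner := sum_choose_mul_choose_mul_rising β (k := k) (mem_antidiagonal.1 hp)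
        calc
          _ = ∑ u ∈ antidiagonal p.2, (-1) ^ p.1 * rising α (k + p.2) * rising g p.1 *
                ((m.choose (p.1 + u.1) : R) * (p.1 + u.1).choose p.1 *
                  (k.descFactorial (p.1 + u.1) * (-1) ^ u.1 * rising β (k + u.2))) := by
              refine Finset.sum_congr rfl fun u hu => ?_
              rw [← mem_antidiagonal.1 hu, add_comm u.1, ← add_assoc]
              ring
          _ = _ := by
              rw [← Finset.mul_sum, inner]
              ring

end AppellIdentity

section Growth

lemma rising_ne_zero {K : Type*} [Field K] {a : K} (ha : ∀ m : ℕ, a ≠ -m) (n : ℕ) :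
    rising a n ≠ 0 := by
  rw [rising, Ne, ascPochhammer_eval_eq_zero_iff]
  exact fun ⟨k, _, hk⟩ => ha k (by rw [hk, neg_neg])

lemma norm_rising_le {𝕜 : Type*} [RCLike 𝕜] {a : 𝕜} {A : ℝ} (hA : ‖a‖ ≤ A) (n : ℕ) :
    ‖rising a n‖ ≤ rising A n := by
  induction n with
  | zero => simp
  | succ n ih =>
    rw [rising_succ, rising_succ, norm_mul]
    refine mul_le_mul ih ?_ (norm_nonneg _) ((norm_nonneg _).trans ih)
    exact (norm_add_le _ _).trans (by simpa using hA)

lemma rising_nonneg {a : ℝ} (ha : 0 ≤ a) (n : ℕ) : 0 ≤ rising a n :=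
  (norm_nonneg _).trans (norm_rising_le (Real.norm_of_nonneg ha).le n)

lemma factorial_le_rising {A : ℝ} (hA : 1 ≤ A) (n : ℕ) : n ! ≤ rising A n := by
  simpa [rising_one_left] using norm_rising_le (a := (1 : ℝ)) (by simpa using hA) n

lemma factorial_le_norm_rising {𝕜 : Type*} [RCLike 𝕜] {a : 𝕜} {N : ℕ} (h : ‖a‖ + 1 ≤ N) (n : ℕ) :
    n ! ≤ ‖rising (a + N) n‖ := by
  induction n with
  | zero => simp
  | succ n ih =>
    have hlast : (n + 1 : ℝ) ≤ ‖a + N + n‖ := by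
      have := norm_sub_le_norm_add ((N + n : ℕ) : 𝕜) a
      rw [RCLike.norm_natCast] at this
      push_cast at this
      rw [add_comm _ a, ← add_assoc] at this
      linarith
    rw [rising_succ, norm_mul, Nat.factorial_succ, mul_comm]
    push_cast
    gcongr

lemma hasSum_rising_mul_pow (a : ℝ) {u : ℝ} (hu : |u| < 1) :
    HasSum (fun n => rising a n / n ! * u ^ n) ((1 - u) ^ (-a)) := by
  have h := (Real.one_div_one_sub_rpow_hasFPowerSeriesOnBall_zero a).hasSum (y := u)
    (by simpa [enorm_eq_nnnorm, ← NNReal.coe_lt_coe] using hu)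
  have hcoeff : ∀ n : ℕ, Ring.choose (a + n - 1) n = rising a n / n ! := fun n => by
    rw [eq_div_iff (by positivity), ← Ring.multichoose_eq, mul_comm, ← nsmul_eq_mul,
      Ring.factorial_nsmul_multichoose_eq_ascPochhammer, Polynomial.ascPochhammer_smeval_eq_eval,
      rising]
  have hu' : 0 ≤ 1 - u := by linarith [le_abs_self u]
  simpa only [zero_add, one_div, ← Real.rpow_neg hu', FormalMultilinearSeries.ofScalars_apply_eq,
    hcoeff, smul_eq_mul] using h

lemma exists_rising_div_factorial_le (A : ℝ) {ρ : ℝ} (hρ : 1 < ρ) :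
    ∃ C, ∀ n : ℕ, rising A n / n ! ≤ C * ρ ^ n := by
  have hsum := (hasSum_rising_mul_pow A (u := ρ⁻¹)
    (by rw [abs_of_pos (by positivity)]; exact inv_lt_one_of_one_lt₀ hρ)).summable
  obtain ⟨C, hC⟩ := hsum.tendsto_atTop_zero.bddAbove_range
  refine ⟨C, fun n => ?_⟩
  rw [← div_le_iff₀ (by positivity), div_eq_mul_inv, ← inv_pow]
  exact hC ⟨n, rfl⟩

lemma factorial_div_norm_rising_le {𝕜 : Type*} [RCLike 𝕜] {c : 𝕜} {M : ℝ} (hM : 1 ≤ M)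
    (hcM : ‖c‖ ≤ M) {N : ℕ} (hN : M + 1 ≤ N) (hcN : rising c N ≠ 0) (n : ℕ) :
    n ! / ‖rising c n‖ ≤ rising M N / ‖rising c N‖ * (rising (M + N) n / n !) := by
  have hswap : ‖rising c n‖ * ‖rising (c + n) N‖ = ‖rising c N‖ * ‖rising (c + N) n‖ := by
    rw [← norm_mul, ← norm_mul, ← rising_add, ← rising_add, add_comm]
  have hswap' : rising M n * rising (M + n) N = rising M N * rising (M + N) n := by
    rw [← rising_add, ← rising_add, add_comm]
  have hshift : ‖rising (c + n) N‖ ≤ rising (M + n) N :=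
    norm_rising_le ((norm_add_le _ _).trans (by simpa using hcM)) N
  have hMn := rising_pos (by linarith : 0 < M) n
  have hMN := rising_pos (by linarith : 0 < M) N
  have hMNn := rising_pos (by positivity : 0 < M + N) n
  replace hcN := norm_pos_iff.2 hcN
  rcases eq_or_ne (rising c n) 0 with hcn | hcn
  · rw [hcn, norm_zero, div_zero]
    positivity
  replace hcn := norm_pos_iff.2 hcn
  rw [div_mul_div_comm, div_le_div_iff₀ hcn (by positivity)]
  calc (n ! : ℝ) * (‖rising c N‖ * n !)
      ≤ rising M n * (‖rising c N‖ * ‖rising (c + N) n‖) := by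
        gcongr
        · exact factorial_le_rising hM n
        · exact factorial_le_norm_rising (hN.trans' (by linarith)) n
    _ ≤ rising M n * (‖rising c n‖ * rising (M + n) N) := by
        rw [← hswap]
        gcongr
    _ = rising M N * rising (M + N) n * ‖rising c n‖ := by rw [← hswap']; ring

lemma continuous_rising {R : Type*} [Semiring R] [TopologicalSpace R] [IsTopologicalSemiring R]
    (n : ℕ) : Continuous fun a : R => rising a n := (ascPochhammer R n).continuous

lemma eventually_factorial_div_norm_rising_le {𝕜 : Type*} [RCLike 𝕜] {c₀ : 𝕜}
    (hc₀ : ∀ m : ℕ, c₀ ≠ -m) {ρ : ℝ} (hρ : 1 < ρ) :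
    ∃ C, ∀ᶠ c in 𝓝 c₀, ∀ n : ℕ, n ! / ‖rising c n‖ ≤ C * ρ ^ n := by
  set M : ℝ := ‖c₀‖ + 1
  obtain ⟨N, hN⟩ := exists_nat_ge (M + 1)
  obtain ⟨C, hC⟩ := exists_rising_div_factorial_le (M + N) hρ
  have hM : 1 ≤ M := by simp [M]
  have hratio : ContinuousAt (fun c : 𝕜 => rising M N / ‖rising c N‖) c₀ :=
    continuousAt_const.div (continuous_rising N).norm.continuousAt
      (norm_ne_zero_iff.2 (rising_ne_zero hc₀ N))
  refine ⟨(rising M N / ‖rising c₀ N‖ + 1) * C, ?_⟩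
  filter_upwards [hratio.eventually_le_const (lt_add_one _),
    continuous_norm.continuousAt.eventually_le_const (lt_add_one _),
    (continuous_rising N).continuousAt.eventually_ne (rising_ne_zero hc₀ N)] with c hCN hcM hcN n
  have hpos : 0 ≤ rising (M + N) n / (n ! : ℝ) :=
    div_nonneg (rising_pos (by positivity) n).le (by positivity)
  calc n ! / ‖rising c n‖ ≤ rising M N / ‖rising c N‖ * (rising (M + N) n / n !) :=
        factorial_div_norm_rising_le hM hcM hN hcN n
    _ ≤ (rising M N / ‖rising c₀ N‖ + 1) * (C * ρ ^ n) :=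
        mul_le_mul hCN (hC n) hpos
          (add_nonneg (div_nonneg (rising_pos (by positivity) N).le (norm_nonneg _)) zero_le_one)
    _ = _ := by ring

end Growth

section AppellSeries

/-- The coefficient of `X ^ i * Y ^ j` in the series of `F₄(α, β; γ, δ; X, Y)`. -/
def appellCoeff (α β γ δ : ℝ) (i j : ℕ) : ℝ :=
  rising α (i + j) * rising β (i + j) / (rising γ i * rising δ j * i ! * j !)

lemma appellF4Term_eq (α β γ δ X Y : ℝ) (p : ℕ × ℕ) :
    appellF4Term α β γ δ X Y p = appellCoeff α β γ δ p.1 p.2 * (X ^ p.1 * Y ^ p.2) := by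
  simp only [appellF4Term, appellSymbol_eq_rising, appellCoeff, mul_assoc]

lemma sum_choose_mul_pow_mul_pow (u v : ℝ) (n : ℕ) :
    ∑ p ∈ antidiagonal n, n.choose p.1 * (u ^ p.1 * v ^ p.2) = (u + v) ^ n := by
  simp only [(Commute.all u v).add_pow', nsmul_eq_mul]

lemma summable_of_summable_sum_antidiagonal {f : ℕ × ℕ → ℝ} (hf : ∀ p, 0 ≤ f p)
    (h : Summable fun n => ∑ p ∈ antidiagonal n, f p) : Summable f := by
  rw [← Finset.HasAntidiagonal.sigmaAntidiagonalEquivProd.summable_iff]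
  refine (summable_sigma_of_nonneg fun x => hf _).2 ⟨fun n => (hasSum_fintype _).summable, ?_⟩
  refine h.congr fun n => ?_
  rw [tsum_fintype]
  exact (Finset.sum_coe_sort (antidiagonal n) f).symm

-- `∑ C(n, i)² Xⁱ Yʲ ≤ (∑ C(n, i) √Xⁱ √Yʲ)² = (√X + √Y)²ⁿ`
lemma summable_choose_sq_mul_pow {X Y : ℝ} (hX : 0 ≤ X) (hY : 0 ≤ Y) (h : √X + √Y < 1) :
    Summable fun p : ℕ × ℕ => ((p.1 + p.2).choose p.1 : ℝ) ^ 2 * (X ^ p.1 * Y ^ p.2) := by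
  refine summable_of_summable_sum_antidiagonal (fun p => by positivity) ?_
  refine (summable_geometric_of_lt_one (r := (√X + √Y) ^ 2) (by positivity)
    (pow_lt_one₀ (by positivity) h two_ne_zero)).of_nonneg_of_le
    (fun n => Finset.sum_nonneg fun p _ => by positivity) fun n => ?_
  calc ∑ p ∈ antidiagonal n, ((p.1 + p.2).choose p.1 : ℝ) ^ 2 * (X ^ p.1 * Y ^ p.2)
      = ∑ p ∈ antidiagonal n, (n.choose p.1 * (√X ^ p.1 * √Y ^ p.2)) ^ 2 := by
        refine Finset.sum_congr rfl fun p hp => ?_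
        rw [mem_antidiagonal.1 hp, mul_pow, mul_pow, ← pow_mul, ← pow_mul, mul_comm p.1,
          mul_comm p.2, pow_mul, pow_mul, Real.sq_sqrt hX, Real.sq_sqrt hY]
    _ ≤ (∑ p ∈ antidiagonal n, n.choose p.1 * (√X ^ p.1 * √Y ^ p.2)) ^ 2 :=
        Finset.sum_sq_le_sq_sum_of_nonneg fun p _ => by positivity
    _ = ((√X + √Y) ^ 2) ^ n := by
        rw [sum_choose_mul_pow_mul_pow, ← pow_mul, ← pow_mul, mul_comm]

lemma abs_appellCoeff (α β γ δ : ℝ) (i j : ℕ) :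
    |appellCoeff α β γ δ i j| = (‖rising α (i + j)‖ / (i + j)!) * (‖rising β (i + j)‖ / (i + j)!) *
      (i ! / ‖rising γ i‖) * (j ! / ‖rising δ j‖) * ((i + j).choose i : ℝ) ^ 2 := by
  have hne : ((i + j).choose i : ℝ) ≠ 0 := by
    exact_mod_cast (Nat.choose_pos (Nat.le_add_right i j)).ne'
  simp only [appellCoeff, abs_div, abs_mul, Nat.abs_cast, Real.norm_eq_abs, factorial_add]
  field_simp

lemma exists_abs_appellCoeff_le (α β : ℝ) {γ δ : ℝ} (hγ : ∀ m : ℕ, γ ≠ -m) (hδ : ∀ m : ℕ, δ ≠ -m)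
    {r : ℝ} (hr : 1 < r) :
    ∃ C, ∀ i j, |appellCoeff α β γ δ i j| ≤
      C * ((r ^ 3) ^ (i + j) * ((i + j).choose i : ℝ) ^ 2) := by
  obtain ⟨A, hA⟩ := exists_rising_div_factorial_le ‖α‖ hr
  obtain ⟨B, hB⟩ := exists_rising_div_factorial_le ‖β‖ hr
  obtain ⟨C, hC⟩ := eventually_factorial_div_norm_rising_le hγ hr
  obtain ⟨D, hD⟩ := eventually_factorial_div_norm_rising_le hδ hr
  replace hA : ∀ n : ℕ, ‖rising α n‖ / n ! ≤ A * r ^ n := fun n =>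
    (div_le_div_of_nonneg_right (norm_rising_le le_rfl n) (by positivity)).trans (hA n)
  replace hB : ∀ n : ℕ, ‖rising β n‖ / n ! ≤ B * r ^ n := fun n =>
    (div_le_div_of_nonneg_right (norm_rising_le le_rfl n) (by positivity)).trans (hB n)
  replace hC := hC.self_of_nhds
  replace hD := hD.self_of_nhds
  refine ⟨A * B * C * D, fun i j => ?_⟩
  have hA0 : 0 ≤ A * r ^ (i + j) := le_trans (by positivity) (hA (i + j))
  have hB0 : 0 ≤ B * r ^ (i + j) := le_trans (by positivity) (hB (i + j))
  have hC0 : 0 ≤ C * r ^ i := le_trans (by positivity) (hC i)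
  calc |appellCoeff α β γ δ i j|
      ≤ (A * r ^ (i + j)) * (B * r ^ (i + j)) * (C * r ^ i) * (D * r ^ j) *
          ((i + j).choose i : ℝ) ^ 2 := by
        rw [abs_appellCoeff]
        gcongr
        exacts [hA _, hB _, hC _, hD _]
    _ = _ := by ring

lemma summable_abs_appellCoeff_mul_pow (α β : ℝ) {γ δ X Y : ℝ} (hγ : ∀ m : ℕ, γ ≠ -m)
    (hδ : ∀ m : ℕ, δ ≠ -m) (hX : 0 ≤ X) (hY : 0 ≤ Y) (h : √X + √Y < 1) :
    Summable fun p : ℕ × ℕ => |appellCoeff α β γ δ p.1 p.2| * (X ^ p.1 * Y ^ p.2) := by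
  have hscale : ∀ᶠ r in 𝓝[>] (1 : ℝ), √(r ^ 3 * X) + √(r ^ 3 * Y) < 1 := by
    have hcont : Continuous fun r : ℝ => √(r ^ 3 * X) + √(r ^ 3 * Y) := by fun_prop
    exact (hcont.tendsto 1).eventually_lt_const (by simpa using h) |>.filter_mono
      nhdsWithin_le_nhds
  obtain ⟨r, hscale, hr⟩ := (hscale.and self_mem_nhdsWithin).exists
  replace hr : 1 < r := hr
  have : 0 < r := by linarith
  obtain ⟨C, hC⟩ := exists_abs_appellCoeff_le α β hγ hδ hr
  refine ((summable_choose_sq_mul_pow (by positivity) (by positivity) hscale).mul_left C)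
    |>.of_nonneg_of_le (fun p => by positivity) fun p => ?_
  calc |appellCoeff α β γ δ p.1 p.2| * (X ^ p.1 * Y ^ p.2)
      ≤ C * ((r ^ 3) ^ (p.1 + p.2) * ((p.1 + p.2).choose p.1 : ℝ) ^ 2) * (X ^ p.1 * Y ^ p.2) := by
        gcongr
        exact hC p.1 p.2
    _ = _ := by ring

end AppellSeries

section AppellExpansion

lemma hasSum_sum_antidiagonal {ι E : Type*} [AddCommMonoid E] [TopologicalSpace E]
    [ContinuousAdd E] [RegularSpace E] {f : ι × (ℕ × ℕ) → E} {s : E} (h : HasSum f s) :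
    HasSum (fun x : ι × ℕ => ∑ v ∈ antidiagonal x.2, f (x.1, v)) s := by
  let e : (Σ x : ι × ℕ, antidiagonal x.2) ≃ ι × (ℕ × ℕ) :=
    (Equiv.sigmaAssocProd (γ := fun _ n => antidiagonal n)).trans <|
      (Equiv.sigmaCongrRight fun _ => Finset.HasAntidiagonal.sigmaAntidiagonalEquivProd).trans
        (Equiv.sigmaEquivProd _ _)
  refine ((e.hasSum_iff (f := f)).2 h).sigma fun x => ?_
  exact (antidiagonal x.2).hasSum (fun v => f (x.1, v)) _

lemma sum_choose_mul_rising_add_mul_rising_add {R : Type*} [CommRing R] (a b : R) (n : ℕ) :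
    ∑ p ∈ antidiagonal n, (n.choose p.1 : R) * (rising (a + p.2) p.1 * rising (b + p.1) p.2)
      = rising (a + b + n - 1) n := by
  have hreflect {c : R} {i j : ℕ} (h : i + j = n) :
      rising (c + j) i = (-1) ^ i * rising (-(c + n - 1)) i := by
    rw [rising_neg_reflect, ← mul_assoc, ← mul_pow, ← h]
    push_cast
    ring_nf
  have hsum : rising (a + b + n - 1) n = (-1) ^ n * rising (-(a + n - 1) + -(b + n - 1)) n := by
    rw [← neg_add, rising_neg_reflect, ← mul_assoc, ← mul_pow]
    ring_nf
  rw [hsum, ← sum_choose_mul_rising_mul_rising, Finset.mul_sum]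
  refine Finset.sum_congr rfl fun p hp => ?_
  have hp' := mem_antidiagonal.1 hp
  have hsign : (-1 : R) ^ n = (-1) ^ p.1 * (-1) ^ p.2 := by rw [← pow_add, hp']
  rw [hreflect hp', hreflect ((add_comm _ _).trans hp'), hsign]
  ring

lemma sum_inv_factorial_mul_rising {K : Type*} [Field K] [CharZero K] {a b : K}
    (ha : ∀ n, rising a n ≠ 0) (hb : ∀ n, rising b n ≠ 0) (m n r : ℕ) :
    ∑ p ∈ antidiagonal r, (p.1 ! * p.2 ! * (rising a (p.2 + m) * rising b (p.1 + n)) : K)⁻¹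
      = rising (a + m + (b + n) + r - 1) r / (r ! * (rising a (r + m) * rising b (r + n))) := by
  rw [← sum_choose_mul_rising_add_mul_rising_add, Finset.sum_div]
  refine Finset.sum_congr rfl fun ⟨i, j⟩ hp => ?_
  obtain rfl := mem_antidiagonal.1 hp
  have hra : rising a (i + j + m) = rising a (j + m) * rising (a + m + j) i := by
    rw [add_assoc, add_comm i, rising_add]
    push_cast
    ring_nf
  have hrb : rising b (i + j + n) = rising b (i + n) * rising (b + n + i) j := by
    rw [add_right_comm, rising_add]
    push_cast
    ring_nf
  have := right_ne_zero_of_mul (hra ▸ ha (i + j + m))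
  have := right_ne_zero_of_mul (hrb ▸ hb (i + j + n))
  have := ha (j + m)
  have := hb (i + n)
  have : ((i + j).choose i : K) ≠ 0 := by
    exact_mod_cast (Nat.choose_pos (Nat.le_add_right i j)).ne'
  rw [hra, hrb, factorial_add]
  field_simp

lemma hasSum_choose_mul_pow (n : ℕ) (u : ℝ) :
    HasSum (fun p => n.choose p * u ^ p) ((1 + u) ^ n) := by
  rw [add_comm, add_pow]
  simp only [one_pow, mul_one]
  simp_rw [mul_comm (u ^ _)]
  refine hasSum_sum_of_ne_finset_zero fun p hp => ?_
  rw [Nat.choose_eq_zero_of_lt (by simpa using hp), Nat.cast_zero, zero_mul]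

lemma hasSum_choose_mul_pow_mul_choose_mul_pow (i j : ℕ) (u v : ℝ) :
    HasSum (fun p : ℕ × ℕ => j.choose p.1 * u ^ p.1 * (i.choose p.2 * v ^ p.2))
      ((1 + u) ^ j * (1 + v) ^ i) := by
  have hu := hasSum_choose_mul_pow j u
  have hv := hasSum_choose_mul_pow i v
  have huv := summable_mul_of_summable_norm hu.summable.norm hv.summable.norm
  exact HasSum.mul hu hv huv

/-- The term of index `((i, j), (p, q))` of the expansion of the series of
`F₄(α, β; γ, δ; x₁ (1 - x₂), x₂ (1 - x₁))` into monomials, where `p` and `q` index the binomial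
expansions of `(1 - x₁) ^ j` and `(1 - x₂) ^ i`. -/
def appellBinomialTerm (α β γ δ x₁ x₂ : ℝ) (y : (ℕ × ℕ) × (ℕ × ℕ)) : ℝ :=
  appellCoeff α β γ δ y.1.1 y.1.2 * (x₁ ^ y.1.1 * x₂ ^ y.1.2) *
    (y.1.2.choose y.2.1 * (-x₁) ^ y.2.1 * (y.1.1.choose y.2.2 * (-x₂) ^ y.2.2))

lemma hasSum_appellBinomialTerm_fiber (α β γ δ x₁ x₂ : ℝ) (u : ℕ × ℕ) :
    HasSum (fun v => appellBinomialTerm α β γ δ x₁ x₂ (u, v))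
      (appellF4Term α β γ δ (x₁ * (1 - x₂)) (x₂ * (1 - x₁)) u) := by
  have h := (hasSum_choose_mul_pow_mul_choose_mul_pow u.1 u.2 (-x₁) (-x₂)).mul_left
    (appellCoeff α β γ δ u.1 u.2 * (x₁ ^ u.1 * x₂ ^ u.2))
  have hsum : appellF4Term α β γ δ (x₁ * (1 - x₂)) (x₂ * (1 - x₁)) u =
      appellCoeff α β γ δ u.1 u.2 * (x₁ ^ u.1 * x₂ ^ u.2) *
        ((1 + -x₁) ^ u.2 * (1 + -x₂) ^ u.1) := by
    rw [appellF4Term_eq, mul_pow, mul_pow]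
    ring
  exact hsum ▸ h

lemma summable_appellBinomialTerm (α β : ℝ) {γ δ x₁ x₂ : ℝ} (hγ : ∀ m : ℕ, γ ≠ -m)
    (hδ : ∀ m : ℕ, δ ≠ -m) (h : √(|x₁| * (1 + |x₂|)) + √(|x₂| * (1 + |x₁|)) < 1) :
    Summable (appellBinomialTerm α β γ δ x₁ x₂) := by
  have hfiber (u : ℕ × ℕ) : HasSum (fun v => ‖appellBinomialTerm α β γ δ x₁ x₂ (u, v)‖)
      (|appellCoeff α β γ δ u.1 u.2| *
        ((|x₁| * (1 + |x₂|)) ^ u.1 * (|x₂| * (1 + |x₁|)) ^ u.2)) := by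
    have h := (hasSum_choose_mul_pow_mul_choose_mul_pow u.1 u.2 |x₁| |x₂|).mul_left
      (|appellCoeff α β γ δ u.1 u.2| * (|x₁| ^ u.1 * |x₂| ^ u.2))
    simp only [appellBinomialTerm, Real.norm_eq_abs, abs_mul, abs_pow, abs_neg, Nat.abs_cast]
    convert! h using 1
    rw [mul_pow, mul_pow]
    ring
  refine .of_norm <| (summable_prod_of_nonneg fun y => norm_nonneg _).2
    ⟨fun u => (hfiber u).summable, ?_⟩
  exact (summable_abs_appellCoeff_mul_pow α β hγ hδ (by positivity) (by positivity) h).congr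
    fun u => (hfiber u).tsum_eq.symm

/-- The term of index `(k, (r, s))` of the expansion of `F₄(α, β; γ, δ; x₁ (1 - x₂), x₂ (1 - x₁))`
in powers of `x₁` and `x₂`, contributing to the coefficient of `x₁ ^ k * x₂ ^ (r + s)`. -/
def appellKnotTerm (α β γ δ x₁ x₂ : ℝ) (y : ℕ × (ℕ × ℕ)) : ℝ :=
  (y.1.descFactorial y.2.1 * (-1) ^ y.2.1 * (rising α (y.1 + y.2.2) * rising β (y.1 + y.2.2) *
    rising (γ + δ - 1 + ↑(y.1 + y.2.2)) y.2.1)) /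
      (rising γ y.1 * rising δ (y.2.1 + y.2.2) * y.1 ! * (y.2.1 ! * y.2.2 !)) *
        (x₁ ^ y.1 * x₂ ^ (y.2.1 + y.2.2))

-- Substituting `i = q + t`, `j = p + s` turns the sum over `p + q = r` into a Vandermonde sum.
lemma sum_appellBinomialTerm (α β : ℝ) {γ δ : ℝ} (x₁ x₂ : ℝ) (hγ : ∀ m : ℕ, γ ≠ -m)
    (hδ : ∀ m : ℕ, δ ≠ -m) (r s t : ℕ) :
    ∑ p ∈ antidiagonal r, appellBinomialTerm α β γ δ x₁ x₂ ((p.2 + t, p.1 + s), p)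
      = appellKnotTerm α β γ δ x₁ x₂ (r + t, (r, s)) := by
  have hterm (p) (hp : p ∈ antidiagonal r) :
      appellBinomialTerm α β γ δ x₁ x₂ ((p.2 + t, p.1 + s), p) =
        (-1) ^ r * (rising α (r + t + s) * rising β (r + t + s)) / (s ! * t !) *
          (x₁ ^ (r + t) * x₂ ^ (r + s)) *
          (p.1 ! * p.2 ! * (rising γ (p.2 + t) * rising δ (p.1 + s)) : ℝ)⁻¹ := by
    obtain ⟨p, q⟩ := p
    obtain rfl := mem_antidiagonal.1 hp
    have : ((p + s).choose p : ℝ) ≠ 0 := by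
      exact_mod_cast (Nat.choose_pos (Nat.le_add_right p s)).ne'
    have : ((q + t).choose q : ℝ) ≠ 0 := by
      exact_mod_cast (Nat.choose_pos (Nat.le_add_right q t)).ne'
    have hidx : q + t + (p + s) = p + q + t + s := by ring
    rw [appellBinomialTerm, appellCoeff, hidx, factorial_add p s, factorial_add q t, neg_pow x₁,
      neg_pow x₂]
    field_simp
    ring
  rw [Finset.sum_congr rfl hterm, ← Finset.mul_sum,
    sum_inv_factorial_mul_rising (rising_ne_zero hγ) (rising_ne_zero hδ)]
  have hdesc : ((r + t)! : ℝ) = t ! * (r + t).descFactorial r := by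
    exact_mod_cast (Nat.add_sub_cancel_left (n := r) (m := t) ▸
      Nat.factorial_mul_descFactorial (Nat.le_add_right r t)).symm
  have : ((r + t).descFactorial r : ℝ) ≠ 0 := by
    exact_mod_cast (Nat.descFactorial_pos.2 (Nat.le_add_right r t)).ne'
  have hparam : γ + t + (δ + s) + r - 1 = γ + δ - 1 + ↑(r + t + s) := by
    push_cast
    ring
  rw [appellKnotTerm, hparam, hdesc]
  field_simp

lemma hasSum_appellKnotTerm (α β : ℝ) {γ δ x₁ x₂ : ℝ} (hγ : ∀ m : ℕ, γ ≠ -m)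
    (hδ : ∀ m : ℕ, δ ≠ -m) (h : √(|x₁| * (1 + |x₂|)) + √(|x₂| * (1 + |x₁|)) < 1) :
    HasSum (appellKnotTerm α β γ δ x₁ x₂)
      (∑' p, appellF4Term α β γ δ (x₁ * (1 - x₂)) (x₂ * (1 - x₁)) p) := by
  let shift : (ℕ × ℕ) × (ℕ × ℕ) → (ℕ × ℕ) × (ℕ × ℕ) := fun y =>
    ((y.2.2 + y.1.2, y.2.1 + y.1.1), y.2)
  have hshift : shift.Injective := by rintro ⟨⟨s, t⟩, p, q⟩ ⟨⟨s', t'⟩, p', q'⟩ h; grind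
  let reindex : (ℕ × ℕ) × ℕ → ℕ × (ℕ × ℕ) := fun y => (y.2 + y.1.2, (y.2, y.1.1))
  have hreindex : reindex.Injective := by rintro ⟨⟨s, t⟩, r⟩ ⟨⟨s', t'⟩, r'⟩ h; grind
  have hbase : HasSum (appellBinomialTerm α β γ δ x₁ x₂)
      (∑' p, appellF4Term α β γ δ (x₁ * (1 - x₂)) (x₂ * (1 - x₁)) p) := by
    have hsum := (summable_appellBinomialTerm α β hγ hδ h).hasSum
    rwa [← (hsum.prod_fiberwise (hasSum_appellBinomialTerm_fiber α β γ δ x₁ x₂)).tsum_eq] at hsum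
  have hshift : HasSum (appellBinomialTerm α β γ δ x₁ x₂ ∘ shift) _ :=
    (hshift.hasSum_iff fun ⟨⟨i, j⟩, p, q⟩ hy => by
      have hlt : i < q ∨ j < p := by
        contrapose! hy
        exact ⟨((j - p, i - q), (p, q)), by grind⟩
      rcases hlt with hlt | hlt <;> simp [appellBinomialTerm, Nat.choose_eq_zero_of_lt hlt]).2 hbase
  refine (hreindex.hasSum_iff fun ⟨k, r, s⟩ hy => ?_).1 ?_
  · have hkr : k < r := by
      contrapose! hy
      exact ⟨((s, k - r), r), by grind⟩
    simp [appellKnotTerm, Nat.descFactorial_of_lt hkr]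
  · convert! hasSum_sum_antidiagonal hshift using 2 with y
    exact (sum_appellBinomialTerm α β x₁ x₂ hγ hδ y.2 y.1.1 y.1.2).symm

end AppellExpansion

section SeveralComplexVariables

variable {E : Type*} [NormedAddCommGroup E] [NormedSpace ℂ E]

/-- Integration against an integrable weight `h`, as a continuous linear functional on the space of
continuous functions on a compact space. -/
def weightedIntegral {T : Type*} [TopologicalSpace T] [CompactSpace T] [MeasurableSpace T]
    [OpensMeasurableSpace T] {μ : Measure T} {h : T → E} (hh : Integrable h μ) : C(T, ℂ) →L[ℂ] E :=
  have hint (g : C(T, ℂ)) : Integrable (fun t => g t • h t) μ :=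
    hh.bdd_smul ‖g‖ g.continuous.aestronglyMeasurable (.of_forall g.norm_coe_le_norm)
  LinearMap.mkContinuous
    { toFun := fun g => ∫ t, g t • h t ∂μ
      map_add' := fun g₁ g₂ => by
        simpa only [ContinuousMap.add_apply, add_smul] using integral_add (hint g₁) (hint g₂)
      map_smul' := fun c g => by
        simpa only [ContinuousMap.smul_apply, smul_assoc, RingHom.id_apply] using
          integral_smul c _ }
    (∫ t, ‖h t‖ ∂μ) fun g => by
      rw [mul_comm, ← integral_const_mul]
      refine norm_integral_le_of_norm_le (hh.norm.const_mul ‖g‖) (.of_forall fun t => ?_)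
      exact (norm_smul_le _ _).trans (by gcongr; exact g.norm_coe_le_norm t)

lemma analyticAt_setIntegral_smul {V X : Type*} [NormedAddCommGroup V] [NormedSpace ℂ V]
    [TopologicalSpace X] [MeasurableSpace X] [BorelSpace X] {K : Set X} [CompactSpace K]
    {μ : Measure X} (hK : MeasurableSet K) {h : X → E} (hh : IntegrableOn h K μ)
    {G : V → X → ℂ} {Φ : V → C(K, ℂ)} {v : V} (hΦ : AnalyticAt ℂ Φ v)
    (hG : ∀ᶠ v' in 𝓝 v, ∀ t : K, Φ v' t = G v' t) :
    AnalyticAt ℂ (fun v => ∫ t in K, G v t • h t ∂μ) v := by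
  have hh' : Integrable (fun t : K => h t) (μ.comap (↑)) := by
    have := (MeasurableEmbedding.subtype_coe hK).integrableOn_iff_comap (by simp) |>.1 hh
    rwa [Subtype.coe_preimage_self, integrableOn_univ] at this
  refine (((weightedIntegral hh').analyticAt _).comp hΦ).congr ?_
  filter_upwards [hG] with v' hv'
  rw [← integral_subtype_comap hK]
  exact integral_congr_ae (.of_forall fun t => congrArg (· • h t) (hv' t))

lemma exists_analyticAt_sub_inv {T : Type*} [TopologicalSpace T] [CompactSpace T] (F : C(T, ℂ))
    {z₀ : ℂ} (hz₀ : ∀ t, F t ≠ z₀) :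
    ∃ Ψ : ℂ → C(T, ℂ), AnalyticAt ℂ Ψ z₀ ∧ ∀ᶠ z in 𝓝 z₀, ∀ t, Ψ z t = (F t - z)⁻¹ := by
  have hlin : AnalyticAt ℂ (fun z => F - algebraMap ℂ C(T, ℂ) z) z₀ :=
    analyticAt_const.sub ((algebraMapCLM ℂ C(T, ℂ)).analyticAt z₀)
  have hunit : IsUnit (F - algebraMap ℂ C(T, ℂ) z₀) :=
    ContinuousMap.isUnit_iff_forall_ne_zero _ |>.2 fun t => sub_ne_zero.2 (hz₀ t)
  refine ⟨fun z => Ring.inverse (F - algebraMap ℂ C(T, ℂ) z),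
    (analyticAt_inverse hunit.unit).comp_of_eq hlin rfl, ?_⟩
  filter_upwards [hlin.continuousAt.eventually (Units.isOpen.mem_nhds hunit)] with z hz t
  have := congrArg (fun g : C(T, ℂ) => g t) (Ring.inverse_mul_cancel _ hz)
  exact eq_inv_of_mul_eq_one_left this

lemma circleIntegral_circleIntegral_eq_setIntegral {g : ℂ × ℂ → E} {a b : ℂ} {r : ℝ} (hr : 0 ≤ r)
    (hg : ContinuousOn g (Metric.sphere a r ×ˢ Metric.sphere b r)) :
    ∮ ζ in C(a, r), ∮ ω in C(b, r), g (ζ, ω) =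
      ∫ θ in Set.Icc 0 (2 * Real.pi) ×ˢ Set.Icc 0 (2 * Real.pi),
        (deriv (circleMap a r) θ.1 * deriv (circleMap b r) θ.2) •
          g (circleMap a r θ.1, circleMap b r θ.2) := by
  have hcont : Continuous fun θ : ℝ × ℝ => (deriv (circleMap a r) θ.1 * deriv (circleMap b r) θ.2) •
      g (circleMap a r θ.1, circleMap b r θ.2) := by
    simp only [deriv_circleMap]
    refine .smul (by fun_prop) (hg.comp_continuous (by fun_prop) fun θ => ?_)
    exact ⟨circleMap_mem_sphere a hr _, circleMap_mem_sphere b hr _⟩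
  rw [Measure.volume_eq_prod, setIntegral_prod _
    (hcont.continuousOn.integrableOn_compact (isCompact_Icc.prod isCompact_Icc))]
  simp only [circleIntegral_def_Icc, mul_smul, integral_smul]

lemma analyticAt_circleIntegral_circleIntegral {f : ℂ × ℂ → E} {a b : ℂ} {r : ℝ} (hr : 0 < r)
    (hf : ContinuousOn f (Metric.sphere a r ×ˢ Metric.sphere b r)) :
    AnalyticAt ℂ (fun p : ℂ × ℂ => ∮ ζ in C(a, r), ∮ ω in C(b, r),
      ((ζ - p.1)⁻¹ * (ω - p.2)⁻¹) • f (ζ, ω)) (a, b) := by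
  let K := Set.Icc 0 (2 * Real.pi) ×ˢ Set.Icc 0 (2 * Real.pi)
  have hKc : IsCompact K := isCompact_Icc.prod isCompact_Icc
  have : CompactSpace K := isCompact_iff_compactSpace.1 hKc
  obtain ⟨Ψ₁, hΨ₁, hΨ₁'⟩ := exists_analyticAt_sub_inv (T := K)
    ⟨fun θ => circleMap a r θ.1.1, by fun_prop⟩ (z₀ := a) fun θ => circleMap_ne_center hr.ne'
  obtain ⟨Ψ₂, hΨ₂, hΨ₂'⟩ := exists_analyticAt_sub_inv (T := K)
    ⟨fun θ => circleMap b r θ.1.2, by fun_prop⟩ (z₀ := b) fun θ => circleMap_ne_center hr.ne'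
  let h : ℝ × ℝ → E := fun θ => (deriv (circleMap a r) θ.1 * deriv (circleMap b r) θ.2) •
    f (circleMap a r θ.1, circleMap b r θ.2)
  have hh : IntegrableOn h K := by
    refine Continuous.continuousOn ?_ |>.integrableOn_compact hKc
    simp only [h, deriv_circleMap]
    exact .smul (by fun_prop) (hf.comp_continuous (by fun_prop) fun θ =>
      ⟨circleMap_mem_sphere a hr.le _, circleMap_mem_sphere b hr.le _⟩)
  have hΨ : AnalyticAt ℂ (fun p : ℂ × ℂ => Ψ₁ p.1 * Ψ₂ p.2) (a, b) :=
    (AnalyticAt.comp (f := Prod.fst) (x := (a, b)) hΨ₁ analyticAt_fst).mul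
      (AnalyticAt.comp (f := Prod.snd) (x := (a, b)) hΨ₂ analyticAt_snd)
  refine (analyticAt_setIntegral_smul hKc.measurableSet hh hΨ (G := fun p θ =>
    (circleMap a r θ.1 - p.1)⁻¹ * (circleMap b r θ.2 - p.2)⁻¹) ?_).congr ?_
  · filter_upwards [continuousAt_fst.eventually hΨ₁', continuousAt_snd.eventually hΨ₂']
      with p h₁ h₂ θ
    rw [ContinuousMap.mul_apply, h₁, h₂]
    rfl
  · filter_upwards [prod_mem_nhds (Metric.ball_mem_nhds a hr) (Metric.ball_mem_nhds b hr)]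
      with p hp
    rw [circleIntegral_circleIntegral_eq_setIntegral
      (g := fun p' => ((p'.1 - p.1)⁻¹ * (p'.2 - p.2)⁻¹) • f p') hr.le]
    · exact integral_congr_ae (.of_forall fun θ => smul_comm _ _ _)
    · refine ContinuousOn.smul (.mul ?_ ?_) hf
      · exact (by fun_prop : Continuous fun p' : ℂ × ℂ => p'.1 - p.1).continuousOn.inv₀
          fun p' hp' => sub_ne_zero.2 (Metric.sphere_disjoint_ball.ne_of_mem hp'.1 hp.1)
      · exact (by fun_prop : Continuous fun p' : ℂ × ℂ => p'.2 - p.2).continuousOn.inv₀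
          fun p' hp' => sub_ne_zero.2 (Metric.sphere_disjoint_ball.ne_of_mem hp'.2 hp.2)

variable [CompleteSpace E]

lemma eq_integral_cauchy_torus {f : ℂ × ℂ → E} {a b : ℂ} {r : ℝ}
    (h1 : ∀ w ∈ Metric.closedBall b r, DiffContOnCl ℂ (fun z => f (z, w)) (Metric.ball a r))
    (h2 : ∀ z ∈ Metric.closedBall a r, DiffContOnCl ℂ (fun w => f (z, w)) (Metric.ball b r))
    {z w : ℂ} (hz : z ∈ Metric.ball a r) (hw : w ∈ Metric.ball b r) :
    (2 * Real.pi * Complex.I : ℂ) ^ 2 • f (z, w) = ∮ ζ in C(a, r), ∮ ω in C(b, r),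
      ((ζ - z)⁻¹ * (ω - w)⁻¹) • f (ζ, ω) := by
  have hr : 0 ≤ r := dist_nonneg.trans hz.le
  rw [pow_two, mul_smul, ← (h1 w (Metric.ball_subset_closedBall hw)).circleIntegral_sub_inv_smul hz,
    ← circleIntegral.integral_smul]
  refine circleIntegral.integral_congr hr fun ζ hζ => ?_
  rw [smul_comm, ← (h2 ζ (Metric.sphere_subset_closedBall hζ)).circleIntegral_sub_inv_smul hw]
  simp only [mul_smul, circleIntegral.integral_smul]

/-- **Osgood's lemma** in two variables. -/
theorem analyticOnNhd_of_separately {U : Set (ℂ × ℂ)} (hU : IsOpen U) {f : ℂ × ℂ → E}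
    (hc : ContinuousOn f U) (h1 : ∀ p ∈ U, DifferentiableAt ℂ (fun z => f (z, p.2)) p.1)
    (h2 : ∀ p ∈ U, DifferentiableAt ℂ (fun w => f (p.1, w)) p.2) : AnalyticOnNhd ℂ f U := by
  rintro ⟨a, b⟩ hp
  obtain ⟨r, hr, hrU⟩ := Metric.nhds_basis_closedBall.mem_iff.1 (hU.mem_nhds hp)
  rw [← closedBall_prod_same] at hrU
  have hsphere : Metric.sphere a r ×ˢ Metric.sphere b r ⊆ U :=
    (Set.prod_mono Metric.sphere_subset_closedBall Metric.sphere_subset_closedBall).trans hrU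
  refine ((analyticAt_circleIntegral_circleIntegral hr (hc.mono hsphere)).const_smul
    (c := ((2 * Real.pi * Complex.I : ℂ) ^ 2)⁻¹)).congr ?_
  filter_upwards [prod_mem_nhds (Metric.ball_mem_nhds a hr) (Metric.ball_mem_nhds b hr)] with p hp
  rw [Pi.smul_apply, inv_smul_eq_iff₀ (by simp [Real.pi_ne_zero])]
  refine (eq_integral_cauchy_torus (fun w hw => ?_) (fun z hz => ?_) hp.1 hp.2).symm
  · exact DifferentiableOn.diffContOnCl fun z hz => (h1 (z, w)
      (hrU ⟨Metric.closure_ball_subset_closedBall hz, hw⟩)).differentiableWithinAt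
  · exact DifferentiableOn.diffContOnCl fun w hw => (h2 (z, w)
      (hrU ⟨hz, Metric.closure_ball_subset_closedBall hw⟩)).differentiableWithinAt

theorem analyticOnNhd_tsum {ι : Type*} {U : Set (ℂ × ℂ)} (hU : IsOpen U) {f : ι → ℂ × ℂ → E}
    (hf : ∀ i, AnalyticOnNhd ℂ (f i) U)
    (hbound : ∀ p ∈ U, ∃ V ∈ 𝓝 p, ∃ u : ι → ℝ, Summable u ∧ ∀ q ∈ V, ∀ i, ‖f i q‖ ≤ u i) :
    AnalyticOnNhd ℂ (fun p => ∑' i, f i p) U := by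
  refine analyticOnNhd_of_separately hU (fun p hp => ?_) (fun p hp => ?_) fun p hp => ?_ <;>
    obtain ⟨V, hV, u, hu, hVu⟩ := hbound p hp <;>
    obtain ⟨W, hWsub, hWo, hpW⟩ := mem_nhds_iff.1 (inter_mem hV (hU.mem_nhds hp))
  · have hcont := continuousOn_tsum
      (fun i q hq => (hf i q (hWsub hq).2).continuousAt.continuousWithinAt) hu
      fun i q hq => hVu q (hWsub hq).1 i
    exact (hcont.continuousAt (hWo.mem_nhds hpW)).continuousWithinAt
  · refine (Complex.differentiableOn_tsum_of_summable_norm hu (F := fun i z => f i (z, p.2))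
      (U := (fun z => (z, p.2)) ⁻¹' W) (fun i z hz => ?_) (hWo.preimage (by fun_prop))
      fun i z hz => hVu _ (hWsub hz).1 i).differentiableAt
      ((hWo.preimage (by fun_prop)).mem_nhds hpW)
    exact ((hf i _ (hWsub hz).2).differentiableAt.comp z (by fun_prop)).differentiableWithinAt
  · refine (Complex.differentiableOn_tsum_of_summable_norm hu (F := fun i w => f i (p.1, w))
      (U := (fun w => (p.1, w)) ⁻¹' W) (fun i w hw => ?_) (hWo.preimage (by fun_prop))
      fun i w hw => hVu _ (hWsub hw).1 i).differentiableAt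
      ((hWo.preimage (by fun_prop)).mem_nhds hpW)
    exact ((hf i _ (hWsub hw).2).differentiableAt.comp w (by fun_prop)).differentiableWithinAt

end SeveralComplexVariables

section DirichletIntegral

/-- The Riemann–Liouville kernel `x ^ (a - 1) / Γ(a)` on `[0, ∞)`, extended by zero. The kernels
form a convolution semigroup in `a`, and the Dirichlet density is a product of them. -/
def powerKernel (a x : ℝ) : ENNReal :=
  if 0 ≤ x then ENNReal.ofReal (x ^ (a - 1) / Real.Gamma a) else 0

@[fun_prop]
lemma measurable_powerKernel (a : ℝ) : Measurable (powerKernel a) :=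
  Measurable.ite measurableSet_Ici (by fun_prop) measurable_const

lemma powerKernel_of_nonneg {a x : ℝ} (hx : 0 ≤ x) :
    powerKernel a x = ENNReal.ofReal (x ^ (a - 1) / Real.Gamma a) := if_pos hx

lemma powerKernel_of_neg {a x : ℝ} (hx : x < 0) : powerKernel a x = 0 := if_neg hx.not_ge

lemma powerKernel_mul_powerKernel {a b s x : ℝ} (ha : 0 < a) (hb : 0 < b) (hs : 0 < s)
    (h0 : x ≠ 0) (h1 : x ≠ s) :
    powerKernel a (s - x) * powerKernel b x
      = powerKernel (a + b) s * (ENNReal.ofReal s⁻¹ * betaPDF b a (s⁻¹ * x)) := by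
  rcases lt_or_gt_of_ne h0 with hx | hx
  · rw [powerKernel_of_neg hx, betaPDF_eq_zero_of_nonpos (by nlinarith [inv_pos.2 hs]), mul_zero,
      mul_zero, mul_zero]
  rcases lt_or_gt_of_ne h1 with hxs | hxs
  · have hsx : 0 < s - x := sub_pos.2 hxs
    have hx1 : s⁻¹ * x < 1 := by rwa [inv_mul_lt_one₀ hs]
    have hsub : 1 - s⁻¹ * x = s⁻¹ * (s - x) := by field_simp
    have hpow : s ^ (a + b - 1) = s ^ (a - 1) * s ^ (b - 1) * s := by
      rw [← Real.rpow_add hs, ← Real.rpow_add_one hs.ne']; ring_nf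
    have := Real.Gamma_pos_of_pos ha
    have := Real.Gamma_pos_of_pos hb
    have := Real.Gamma_pos_of_pos (add_pos hb ha)
    rw [betaPDF_of_pos_lt_one (by positivity) hx1, powerKernel_of_nonneg hsx.le,
      powerKernel_of_nonneg hx.le, powerKernel_of_nonneg hs.le, hsub, beta,
      ← ENNReal.ofReal_mul (by positivity), ← ENNReal.ofReal_mul (by positivity),
      ← ENNReal.ofReal_mul (by positivity), Real.mul_rpow (by positivity) hx.le,
      Real.mul_rpow (by positivity) hsx.le, Real.inv_rpow hs.le, Real.inv_rpow hs.le, hpow,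
      add_comm a b]
    congr 1
    field_simp
  · rw [powerKernel_of_neg (sub_neg.2 hxs),
      betaPDF_eq_zero_of_one_le (by rw [le_inv_mul_iff₀ hs]; linarith), zero_mul, mul_zero,
      mul_zero]

lemma lintegral_powerKernel_mul_powerKernel {a b s : ℝ} (ha : 0 < a) (hb : 0 < b) (hs : s ≠ 0) :
    ∫⁻ x, powerKernel a (s - x) * powerKernel b x = powerKernel (a + b) s := by
  rcases lt_or_gt_of_ne hs with hs | hs
  · rw [powerKernel_of_neg hs, lintegral_eq_zero_of_ae_eq_zero]
    refine .of_forall fun x => ?_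
    rcases lt_or_ge x 0 with hx | hx
    · simp [powerKernel_of_neg hx]
    · simp [powerKernel_of_neg (show s - x < 0 by linarith)]
  have hscale : ENNReal.ofReal s⁻¹ * ∫⁻ x, betaPDF b a (s⁻¹ * x) = 1 := by
    have hmap := Real.smul_map_volume_mul_left (inv_ne_zero hs.ne')
    rw [abs_of_pos (inv_pos.2 hs)] at hmap
    rw [← lintegral_map (by unfold betaPDF; fun_prop) (measurable_const_mul s⁻¹), ← smul_eq_mul,
      ← lintegral_smul_measure, hmap, lintegral_betaPDF_eq_one hb ha]
  calc ∫⁻ x, powerKernel a (s - x) * powerKernel b x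
      = ∫⁻ x, powerKernel (a + b) s * (ENNReal.ofReal s⁻¹ * betaPDF b a (s⁻¹ * x)) := by
        refine lintegral_congr_ae ?_
        filter_upwards [Measure.ae_ne volume 0, Measure.ae_ne volume s] with x h0 h1
        exact powerKernel_mul_powerKernel ha hb hs h0 h1
    _ = powerKernel (a + b) s := by
        rw [lintegral_const_mul _ (by unfold betaPDF; fun_prop),
          lintegral_const_mul _ (by unfold betaPDF; fun_prop), hscale, mul_one]

lemma lintegral_fin_cons {n : ℕ} {f : (Fin (n + 1) → ℝ) → ENNReal} (hf : Measurable f) :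
    ∫⁻ t, f t = ∫⁻ x : ℝ, ∫⁻ r : Fin n → ℝ, f (Fin.cons x r) := by
  rw [← (volume_preserving_piFinSuccAbove (fun _ => ℝ) 0).symm.lintegral_comp hf,
    Measure.volume_eq_prod, lintegral_prod _ (by fun_prop)]
  simp only [MeasurableEquiv.piFinSuccAbove_symm_apply, Fin.insertNthEquiv_zero]
  rfl

lemma lintegral_powerKernel_mul_prod {n : ℕ} {a : ℝ} (ha : 0 < a) {b : Fin n → ℝ}
    (hb : ∀ j, 0 < b j) {s : ℝ} (hs : s ≠ 0) :
    ∫⁻ t : Fin n → ℝ, powerKernel a (s - ∑ j, t j) * ∏ j, powerKernel (b j) (t j)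
      = powerKernel (a + ∑ j, b j) s := by
  induction n generalizing s with
  | zero => simp [volume_pi]
  | succ n ih =>
    have hsum : 0 ≤ ∑ j : Fin n, b j.succ := Finset.sum_nonneg fun j _ => (hb j.succ).le
    rw [lintegral_fin_cons (by fun_prop)]
    calc ∫⁻ x : ℝ, ∫⁻ r : Fin n → ℝ, powerKernel a (s - ∑ j, Fin.cons (α := fun _ => ℝ) x r j) *
            ∏ j, powerKernel (b j) (Fin.cons (α := fun _ => ℝ) x r j)
        = ∫⁻ x : ℝ, powerKernel (a + ∑ j : Fin n, b j.succ) (s - x) * powerKernel (b 0) x := by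
          refine lintegral_congr_ae ?_
          filter_upwards [Measure.ae_ne volume s] with x hx
          rw [← ih (fun j => hb j.succ) (sub_ne_zero.2 hx.symm),
            ← lintegral_mul_const _ (by fun_prop)]
          refine lintegral_congr fun r => ?_
          simp only [Fin.sum_univ_succ, Fin.prod_univ_succ, Fin.cons_zero, Fin.cons_succ, sub_sub]
          ring
      _ = powerKernel (a + ∑ j, b j) s := by
          rw [lintegral_powerKernel_mul_powerKernel (by positivity) (hb 0) hs,
            Fin.sum_univ_succ]
          ring_nf

variable {n : ℕ} {b : Fin (n + 1) → ℝ} {t : Fin n → ℝ}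

lemma isCompact_simplexE (n : ℕ) : IsCompact (simplexE n) := by
  refine Metric.isCompact_of_isClosed_isBounded ?_ ?_
  · simp only [simplexE, Set.ofPred_and, Set.ofPred_forall]
    exact (isClosed_iInter fun j => isClosed_le continuous_const (continuous_apply j)).inter
      (isClosed_le (by fun_prop) continuous_const)
  · refine (Metric.isBounded_Icc (0 : Fin n → ℝ) 1).subset fun t ht => ⟨ht.1, fun j => ?_⟩
    exact (Finset.single_le_sum (fun j _ => ht.1 j) (Finset.mem_univ j)).trans ht.2

lemma measurableSet_simplexE (n : ℕ) : MeasurableSet (simplexE n) :=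
  (isCompact_simplexE n).measurableSet

lemma mem_simplexE_iff : t ∈ simplexE n ↔ ∀ i, 0 ≤ bary t i := by
  simp [Fin.forall_fin_succ, bary, simplexE, and_comm]

lemma bary_nonneg (ht : t ∈ simplexE n) (i : Fin (n + 1)) : 0 ≤ bary t i :=
  mem_simplexE_iff.1 ht i

lemma sum_bary (t : Fin n → ℝ) : ∑ i, bary t i = 1 := by
  simp [bary, Fin.sum_univ_succ]

@[fun_prop]
lemma continuous_bary : Continuous (bary : (Fin n → ℝ) → Fin (n + 1) → ℝ) := by
  refine continuous_pi fun i => Fin.cases ?_ (fun j => ?_) i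
  · simp only [bary, Fin.cons_zero]; fun_prop
  · simp only [bary, Fin.cons_succ]; fun_prop

lemma dirichletDensity_nonneg (hb : ∀ i, 0 < b i) (ht : t ∈ simplexE n) :
    0 ≤ dirichletDensity b t :=
  mul_nonneg (Real.Gamma_pos_of_pos (Finset.sum_pos (fun i _ => hb i) (by simp))).le
    (Finset.prod_nonneg fun i _ => mul_nonneg (inv_nonneg.2 (Real.Gamma_pos_of_pos (hb i)).le)
      (Real.rpow_nonneg (bary_nonneg ht i) _))

lemma measurable_dirichletDensity (b : Fin (n + 1) → ℝ) : Measurable (dirichletDensity b) := by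
  have (i : Fin (n + 1)) : Measurable fun t : Fin n → ℝ => bary t i :=
    ((continuous_apply i).comp continuous_bary).measurable
  unfold dirichletDensity
  fun_prop

lemma indicator_ofReal_dirichletDensity (hb : ∀ i, 0 < b i) (t : Fin n → ℝ) :
    (simplexE n).indicator (fun t => ENNReal.ofReal (dirichletDensity b t)) t
      = ENNReal.ofReal (Real.Gamma (∑ i, b i)) * ∏ i, powerKernel (b i) (bary t i) := by
  by_cases ht : t ∈ simplexE n
  · have hfac (i : Fin (n + 1)) : 0 ≤ (Real.Gamma (b i))⁻¹ * bary t i ^ (b i - 1) :=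
      mul_nonneg (inv_nonneg.2 (Real.Gamma_pos_of_pos (hb i)).le)
        (Real.rpow_nonneg (bary_nonneg ht i) _)
    rw [Set.indicator_of_mem ht, dirichletDensity,
      ENNReal.ofReal_mul' (Finset.prod_nonneg fun i _ => hfac i),
      ENNReal.ofReal_prod_of_nonneg fun i _ => hfac i]
    simp only [powerKernel_of_nonneg (bary_nonneg ht _), div_eq_inv_mul]
  · obtain ⟨i, hi⟩ := not_forall.1 fun h => ht (mem_simplexE_iff.2 h)
    rw [Set.indicator_of_notMem ht, Finset.prod_eq_zero (Finset.mem_univ i)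
      (powerKernel_of_neg (not_le.1 hi)), mul_zero]

lemma lintegral_dirichletDensity (hb : ∀ i, 0 < b i) :
    ∫⁻ t in simplexE n, ENNReal.ofReal (dirichletDensity b t) = 1 := by
  have hΓ : 0 < Real.Gamma (∑ i, b i) :=
    Real.Gamma_pos_of_pos (Finset.sum_pos (fun i _ => hb i) (by simp))
  have hprod (t : Fin n → ℝ) : ∏ i, powerKernel (b i) (bary t i)
      = powerKernel (b 0) (1 - ∑ j, t j) * ∏ j : Fin n, powerKernel (b j.succ) (t j) := by
    simp only [Fin.prod_univ_succ, bary, Fin.cons_zero, Fin.cons_succ]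
  rw [← lintegral_indicator (measurableSet_simplexE n)]
  simp only [indicator_ofReal_dirichletDensity hb, hprod]
  rw [lintegral_const_mul _ (by fun_prop),
    lintegral_powerKernel_mul_prod (hb 0) (fun j => hb j.succ) one_ne_zero, ← Fin.sum_univ_succ,
    powerKernel_of_nonneg zero_le_one, ← ENNReal.ofReal_mul hΓ.le, Real.one_rpow,
    mul_one_div_cancel hΓ.ne', ENNReal.ofReal_one]

lemma integrableOn_dirichletDensity (hb : ∀ i, 0 < b i) :
    IntegrableOn (dirichletDensity b) (simplexE n) := by
  refine ⟨(measurable_dirichletDensity b).aestronglyMeasurable, ?_⟩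
  rw [hasFiniteIntegral_iff_ofReal (ae_restrict_of_forall_mem (measurableSet_simplexE n)
    fun t ht => dirichletDensity_nonneg hb ht), lintegral_dirichletDensity hb]
  exact ENNReal.one_lt_top

lemma integral_dirichletDensity (hb : ∀ i, 0 < b i) :
    ∫ t in simplexE n, dirichletDensity b t = 1 := by
  rw [integral_eq_lintegral_of_nonneg_ae (ae_restrict_of_forall_mem (measurableSet_simplexE n)
    fun t ht => dirichletDensity_nonneg hb ht) (measurable_dirichletDensity b).aestronglyMeasurable,
    lintegral_dirichletDensity hb, ENNReal.toReal_one]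

lemma Gamma_add_natCast {a : ℝ} (ha : 0 < a) (n : ℕ) :
    Real.Gamma (a + n) = Real.Gamma a * rising a n := by
  induction n with
  | zero => simp
  | succ n ih =>
    rw [Nat.cast_succ, ← add_assoc, Real.Gamma_add_one (by positivity), ih, rising_succ]
    ring

lemma prod_bary_pow_mul_dirichletDensity (hb : ∀ i, 0 < b i) (k : Fin (n + 1) → ℕ)
    (ht : t ∈ simplexE n) :
    (∏ i, bary t i ^ k i) * dirichletDensity b t
      = (∏ i, rising (b i) (k i)) / rising (∑ i, b i) (∑ i, k i)
        * dirichletDensity (fun i => b i + k i) t := by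
  have hsum : 0 < ∑ i, b i := Finset.sum_pos (fun i _ => hb i) (by simp)
  have hfac (i : Fin (n + 1)) : bary t i ^ k i * ((Real.Gamma (b i))⁻¹ * bary t i ^ (b i - 1))
      = rising (b i) (k i) * ((Real.Gamma (b i + k i))⁻¹ * bary t i ^ (b i + k i - 1)) := by
    have := Real.Gamma_pos_of_pos (hb i)
    have := rising_pos (hb i) (k i)
    have hpow : bary t i ^ (b i + k i - 1) = bary t i ^ (b i - 1) * bary t i ^ k i := by
      obtain hk | hk := (k i).eq_zero_or_pos
      · simp [hk]
      · have : (1 : ℝ) ≤ k i := by exact_mod_cast hk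
        rw [← Real.rpow_add_natCast' (bary_nonneg ht i) (by linarith [hb i])]
        ring_nf
    rw [Gamma_add_natCast (hb i), hpow]
    field_simp
  have := rising_pos hsum (∑ i, k i)
  rw [dirichletDensity, dirichletDensity, Finset.sum_add_distrib, ← Nat.cast_sum,
    Gamma_add_natCast hsum, mul_left_comm, ← Finset.prod_mul_distrib]
  simp only [hfac]
  rw [Finset.prod_mul_distrib]
  field_simp

lemma integral_prod_bary_pow_mul_dirichletDensity (hb : ∀ i, 0 < b i) (k : Fin (n + 1) → ℕ) :
    ∫ t in simplexE n, (∏ i, bary t i ^ k i) * dirichletDensity b t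
      = (∏ i, rising (b i) (k i)) / rising (∑ i, b i) (∑ i, k i) := by
  rw [setIntegral_congr_fun (measurableSet_simplexE n) fun t ht =>
    prod_bary_pow_mul_dirichletDensity hb k ht, integral_const_mul,
    integral_dirichletDensity fun i => add_pos_of_pos_of_nonneg (hb i) (k i).cast_nonneg, mul_one]

lemma integrableOn_mul_dirichletDensity {b : Fin (n + 1) → ℝ} (hb : ∀ i, 0 < b i)
    {f : (Fin n → ℝ) → ℝ} (hf : ContinuousOn f (simplexE n)) :
    IntegrableOn (fun t => f t * dirichletDensity b t) (simplexE n) :=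
  (integrableOn_dirichletDensity hb).continuousOn_mul hf (isCompact_simplexE n)

lemma hasSum_integral_mul_dirichletDensity {b : Fin (n + 1) → ℝ} (hb : ∀ i, 0 < b i) {ι : Type*}
    [Countable ι] {f : ι → (Fin n → ℝ) → ℝ} (hf : ∀ i, Continuous (f i)) {u : ι → ℝ}
    (hu : Summable u) (hfu : ∀ i, ∀ t ∈ simplexE n, |f i t| ≤ u i) {g : (Fin n → ℝ) → ℝ}
    (hg : ∀ t ∈ simplexE n, HasSum (fun i => f i t) (g t)) :
    HasSum (fun i => ∫ t in simplexE n, f i t * dirichletDensity b t)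
      (∫ t in simplexE n, g t * dirichletDensity b t) := by
  have hint (i : ι) : IntegrableOn (fun t => f i t * dirichletDensity b t) (simplexE n) :=
    integrableOn_mul_dirichletDensity hb (hf i).continuousOn
  have hnorm (i : ι) : ∫ t in simplexE n, ‖f i t * dirichletDensity b t‖ ≤ u i := by
    calc ∫ t in simplexE n, ‖f i t * dirichletDensity b t‖
        ≤ ∫ t in simplexE n, u i * dirichletDensity b t := by
          refine setIntegral_mono_on (hint i).norm ((integrableOn_dirichletDensity hb).const_mul _)
            (measurableSet_simplexE n) fun t ht => ?_
          have hnonneg := dirichletDensity_nonneg hb ht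
          rw [Real.norm_eq_abs, abs_mul, abs_of_nonneg hnonneg]
          exact mul_le_mul_of_nonneg_right (hfu i t ht) hnonneg
      _ = u i := by rw [integral_const_mul, integral_dirichletDensity hb, mul_one]
  have hsum := hasSum_integral_of_summable_integral_norm hint
    (.of_nonneg_of_le (fun i => integral_nonneg fun t => norm_nonneg _) hnorm hu)
  rwa [setIntegral_congr_fun (measurableSet_simplexE n) fun t ht =>
    ((hg t ht).mul_right (dirichletDensity b t)).tsum_eq] at hsum

end DirichletIntegral

section HyperR

/-- The `n`-th term of the expansion of `l ^ a R_{-a}(b₀, b₁; z₀, z₁)` in powers of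
`ξ = 1 - z₀ / l` and `η = 1 - z₁ / l`. The variables `ξ`, `η` range over an algebra, so that the
terms can also be viewed as elements of a space of continuous functions. -/
def hyperRTerm {K A : Type*} [Field K] [CommRing A] [Algebra K A] (a b₀ b₁ : K) (ξ η : A) (n : ℕ) :
    A :=
  ∑ p ∈ antidiagonal n, (rising a n / rising (b₀ + b₁) n *
    (rising b₀ p.1 / p.1 ! * (rising b₁ p.2 / p.2 !))) • (ξ ^ p.1 * η ^ p.2)

lemma hyperRTerm_zero_right {K A : Type*} [Field K] [CommRing A] [Algebra K A] (a b₀ b₁ : K) (ξ : A)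
    (n : ℕ) : hyperRTerm a b₀ b₁ ξ 0 n
      = (rising a n * rising b₀ n / (rising (b₀ + b₁) n * n !)) • ξ ^ n := by
  rw [hyperRTerm, Finset.sum_eq_single (n, 0)]
  · simp only [rising_zero, Nat.factorial_zero, Nat.cast_one, pow_zero, mul_one, div_one,
      div_mul_div_comm]
  · rintro ⟨i, j⟩ hp hne
    have hj : j ≠ 0 := by
      rintro rfl
      exact hne (by simpa using hp)
    simp [hj]
  · simp

lemma map_hyperRTerm {K A B : Type*} [Field K] [CommRing A] [Algebra K A] [CommRing B] [Algebra K B]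
    (f : A →ₐ[K] B) (a b₀ b₁ : K) (ξ η : A) (n : ℕ) :
    f (hyperRTerm a b₀ b₁ ξ η n) = hyperRTerm a b₀ b₁ (f ξ) (f η) n := by
  simp only [hyperRTerm, map_sum, map_smul, map_mul, map_pow]

lemma ofReal_hyperRTerm (a b₀ b₁ ξ η : ℝ) (n : ℕ) :
    ((hyperRTerm a b₀ b₁ ξ η n : ℝ) : ℂ)
      = hyperRTerm (a : ℂ) (b₀ : ℂ) (b₁ : ℂ) (ξ : ℂ) (η : ℂ) n := by
  have hrising (x : ℝ) (m : ℕ) : ((rising x m : ℝ) : ℂ) = rising (x : ℂ) m :=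
    map_rising Complex.ofRealHom x m
  simp only [hyperRTerm, smul_eq_mul]
  push_cast [hrising]
  rfl

variable {A : Type*} [NormedCommRing A] [NormedAlgebra ℂ A]

lemma norm_hyperRTerm_le [NormOneClass A] {a b₀ b₁ : ℂ} {ξ η : A} {B ρ : ℝ}
    (hB : ‖b₀‖ + ‖b₁‖ ≤ B) (hξ : ‖ξ‖ ≤ ρ) (hη : ‖η‖ ≤ ρ) (n : ℕ) :
    ‖hyperRTerm a b₀ b₁ ξ η n‖ ≤ rising ‖a‖ n / n ! * (n ! / ‖rising (b₀ + b₁) n‖) *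
      (rising B n / n ! * ρ ^ n) := by
  have hρ : 0 ≤ ρ := (norm_nonneg _).trans hξ
  have hterm : ∀ p ∈ antidiagonal n,
      ‖(rising a n / rising (b₀ + b₁) n *
        (rising b₀ p.1 / p.1 ! * (rising b₁ p.2 / p.2 !))) • (ξ ^ p.1 * η ^ p.2)‖
      ≤ rising ‖a‖ n / ‖rising (b₀ + b₁) n‖ *
        (rising ‖b₀‖ p.1 / p.1 ! * (rising ‖b₁‖ p.2 / p.2 !)) * ρ ^ n := fun p hp => by
    rw [← mem_antidiagonal.1 hp, pow_add]
    have hpow : ‖ξ ^ p.1 * η ^ p.2‖ ≤ ρ ^ p.1 * ρ ^ p.2 :=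
      norm_mul_le_of_le ((norm_pow_le ξ _).trans (by gcongr)) ((norm_pow_le η _).trans (by gcongr))
    simp only [norm_smul, norm_mul, norm_div, RCLike.norm_natCast]
    have := rising_nonneg (norm_nonneg a) (p.1 + p.2)
    have := rising_nonneg (norm_nonneg b₀) p.1
    have := rising_nonneg (norm_nonneg b₁) p.2
    gcongr <;> exact norm_rising_le le_rfl _
  have hmono : rising (‖b₀‖ + ‖b₁‖) n ≤ rising B n := by
    have hnorm : ‖‖b₀‖ + ‖b₁‖‖ ≤ B := by rwa [Real.norm_of_nonneg (by positivity)]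
    exact (le_abs_self _).trans (norm_rising_le hnorm n)
  have := rising_nonneg (norm_nonneg a) n
  calc ‖hyperRTerm a b₀ b₁ ξ η n‖
      ≤ rising ‖a‖ n / ‖rising (b₀ + b₁) n‖ * (rising (‖b₀‖ + ‖b₁‖) n / n !) * ρ ^ n := by
        rw [← sum_rising_div_factorial_mul, Finset.mul_sum, Finset.sum_mul]
        exact norm_sum_le_of_le _ hterm
    _ ≤ rising ‖a‖ n / ‖rising (b₀ + b₁) n‖ * (rising B n / n !) * ρ ^ n := by gcongr
    _ = _ := by field_simp

lemma exists_one_lt_pow_mul_lt_one {ρ : ℝ} (hρ : ρ < 1) (k : ℕ) :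
    ∃ r : ℝ, 1 < r ∧ r ^ k * ρ < 1 := by
  have hcont : ContinuousAt (fun r : ℝ => r ^ k * ρ) 1 := by fun_prop
  have hev := hcont.eventually (eventually_lt_nhds (b := 1) (by simpa using hρ))
  obtain ⟨r, hr, hr1⟩ := ((hev.filter_mono nhdsWithin_le_nhds).and
    (self_mem_nhdsWithin : Set.Ioi (1 : ℝ) ∈ 𝓝[>] 1)).exists
  exact ⟨r, hr1, hr⟩

lemma exists_summable_norm_hyperRTerm_le [NormOneClass A] (a : ℂ) {b₀ b₁ : ℂ}
    (hc : ∀ m : ℕ, b₀ + b₁ ≠ -m) {ρ : ℝ} (hρ0 : 0 ≤ ρ) (hρ : ρ < 1) :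
    ∃ u : ℕ → ℝ, Summable u ∧ ∀ᶠ q : ℂ × ℂ in 𝓝 (b₀, b₁), ∀ n, ∀ ξ η : A, ‖ξ‖ ≤ ρ → ‖η‖ ≤ ρ →
      ‖hyperRTerm a q.1 q.2 ξ η n‖ ≤ u n := by
  obtain ⟨r, hr1, hr⟩ := exists_one_lt_pow_mul_lt_one hρ 3
  set B : ℝ := ‖b₀‖ + ‖b₁‖ + 1
  have hB : 0 < B := by positivity
  obtain ⟨C₁, hC₁⟩ := exists_rising_div_factorial_le ‖a‖ hr1
  obtain ⟨C₂, hC₂⟩ := exists_rising_div_factorial_le B hr1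
  obtain ⟨C₃, hC₃⟩ := eventually_factorial_div_norm_rising_le hc hr1
  refine ⟨fun n => C₁ * C₃ * C₂ * (r ^ 3 * ρ) ^ n,
    (summable_geometric_of_lt_one (by positivity) hr).mul_left _, ?_⟩
  have hadd : ContinuousAt (fun q : ℂ × ℂ => q.1 + q.2) (b₀, b₁) := by fun_prop
  have hnorm : ContinuousAt (fun q : ℂ × ℂ => ‖q.1‖ + ‖q.2‖) (b₀, b₁) := by fun_prop
  filter_upwards [hadd.eventually hC₃, hnorm.eventually_le_const (lt_add_one _)]
    with q hq hqB n ξ η hξ hη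
  have ha : 0 ≤ rising ‖a‖ n := rising_nonneg (norm_nonneg a) n
  have := rising_pos hB n
  have hC : 0 ≤ C₁ * r ^ n := le_trans (by positivity) (hC₁ n)
  calc ‖hyperRTerm a q.1 q.2 ξ η n‖
      ≤ rising ‖a‖ n / n ! * (n ! / ‖rising (q.1 + q.2) n‖) * (rising B n / n ! * ρ ^ n) :=
        norm_hyperRTerm_le hqB hξ hη n
    _ ≤ (C₁ * r ^ n) * (C₃ * r ^ n) * ((C₂ * r ^ n) * ρ ^ n) := by
        have := (show 0 ≤ n ! / ‖rising (q.1 + q.2) n‖ by positivity).trans (hq n)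
        gcongr
        exacts [hC₁ n, hq n, hC₂ n]
    _ = C₁ * C₃ * C₂ * (r ^ 3 * ρ) ^ n := by ring

lemma analyticAt_rising {V : Type*} [NormedAddCommGroup V] [NormedSpace ℂ V] {f : V → ℂ} {v : V}
    (hf : AnalyticAt ℂ f v) (n : ℕ) : AnalyticAt ℂ (fun w => rising (f w) n) v := by
  induction n with
  | zero => simpa using analyticAt_const
  | succ n ih =>
    simp only [rising_succ]
    exact ih.fun_mul (hf.fun_add analyticAt_const)

lemma analyticAt_hyperRTerm (a : ℂ) {q : ℂ × ℂ} (hc : ∀ m : ℕ, q.1 + q.2 ≠ -m) (ξ η : ℂ) (n : ℕ) :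
    AnalyticAt ℂ (fun q : ℂ × ℂ => hyperRTerm a q.1 q.2 ξ η n) q := by
  simp only [hyperRTerm, smul_eq_mul]
  refine Finset.analyticAt_fun_sum _ fun p _ => AnalyticAt.fun_mul (AnalyticAt.fun_mul
    (analyticAt_const.fun_div (analyticAt_rising (analyticAt_fst.fun_add analyticAt_snd) n)
      (rising_ne_zero hc n)) (.fun_mul ?_ ?_)) analyticAt_const
  · exact (analyticAt_rising analyticAt_fst _).fun_div analyticAt_const
      (Nat.cast_ne_zero.2 (Nat.factorial_ne_zero _))
  · exact (analyticAt_rising analyticAt_snd _).fun_div analyticAt_const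
      (Nat.cast_ne_zero.2 (Nat.factorial_ne_zero _))

lemma isOpen_setOf_forall_ne_neg_natCast : IsOpen {c : ℂ | ∀ m : ℕ, c ≠ -m} := by
  have hrange : IsClosed (Set.range ((↑) : ℕ → ℂ)) :=
    (Complex.isometry_ofReal.isClosedEmbedding.comp Nat.isClosedEmbedding_coe_real).isClosed_range
  convert (hrange.preimage continuous_neg).isOpen_compl using 1
  ext c
  simp [eq_neg_iff_add_eq_zero, add_comm c]

lemma analyticOnNhd_tsum_hyperRTerm (a : ℂ) {ξ η : ℂ} (hξ : ‖ξ‖ < 1) (hη : ‖η‖ < 1) :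
    AnalyticOnNhd ℂ (fun q : ℂ × ℂ => ∑' n, hyperRTerm a q.1 q.2 ξ η n)
      {q | ∀ m : ℕ, q.1 + q.2 ≠ -m} := by
  have hopen : IsOpen {q : ℂ × ℂ | ∀ m : ℕ, q.1 + q.2 ≠ -m} :=
    isOpen_setOf_forall_ne_neg_natCast.preimage continuous_add
  refine analyticOnNhd_tsum hopen (fun n q hq => analyticAt_hyperRTerm a hq ξ η n) fun q hq => ?_
  obtain ⟨u, hu, hle⟩ := exists_summable_norm_hyperRTerm_le (A := ℂ) a hq (ρ := max ‖ξ‖ ‖η‖)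
    ((norm_nonneg ξ).trans (le_max_left _ _)) (max_lt hξ hη)
  exact ⟨_, hle, u, hu, fun q' hq' n => hq' n ξ η (le_max_left _ _) (le_max_right _ _)⟩

lemma abs_one_sub_div_lt_one {z l : ℝ} (hz : 0 < z) (hzl : z < 2 * l) : |1 - z / l| < 1 := by
  have hl : 0 < l := by linarith
  have := div_pos hz hl
  have : z / l < 2 := (div_lt_iff₀ hl).2 hzl
  rw [abs_lt]
  constructor <;> linarith

lemma norm_sum_bary_smul_le {n : ℕ} {t : Fin n → ℝ} (ht : t ∈ simplexE n) {E : Type*}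
    [NormedAddCommGroup E] [NormedSpace ℝ E] {ξ : Fin (n + 1) → E} {ρ : ℝ} (hξ : ∀ i, ‖ξ i‖ ≤ ρ) :
    ‖∑ i, bary t i • ξ i‖ ≤ ρ :=
  mem_closedBall_zero_iff.1 <| (convex_closedBall (0 : E) ρ).sum_mem (fun i _ => bary_nonneg ht i)
    (sum_bary t) fun i _ => mem_closedBall_zero_iff.2 (hξ i)

lemma integral_sum_bary_mul_pow_two {b : Fin 2 → ℝ} (hb : ∀ i, 0 < b i) (a : ℝ) (ξ : Fin 2 → ℝ)
    (n : ℕ) :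
    ∫ t in simplexE 1, rising a n / n ! * (∑ i, bary t i * ξ i) ^ n * dirichletDensity b t
      = hyperRTerm a (b 0) (b 1) (ξ 0) (ξ 1) n := by
  have hexp (t : Fin 1 → ℝ) :
      rising a n / n ! * (∑ i, bary t i * ξ i) ^ n * dirichletDensity b t
        = ∑ p ∈ antidiagonal n, rising a n / n ! * (n.choose p.1 * (ξ 0 ^ p.1 * ξ 1 ^ p.2)) *
          ((∏ i, bary t i ^ ![p.1, p.2] i) * dirichletDensity b t) := by
    rw [Fin.sum_univ_two (fun i => bary t i * ξ i), (Commute.all _ _).add_pow', Finset.mul_sum,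
      Finset.sum_mul]
    refine Finset.sum_congr rfl fun p _ => ?_
    rw [Fin.prod_univ_two (fun i => bary t i ^ ![p.1, p.2] i)]
    simp only [nsmul_eq_mul, mul_pow, Matrix.cons_val_zero, Matrix.cons_val_one]
    ring
  have hint (k : Fin 2 → ℕ) :
      IntegrableOn (fun t => (∏ i, bary t i ^ k i) * dirichletDensity b t) (simplexE 1) :=
    integrableOn_mul_dirichletDensity hb (Continuous.continuousOn (by fun_prop))
  simp only [hexp]
  rw [integral_finsetSum _ fun p _ => (hint _).const_mul _, hyperRTerm]
  refine Finset.sum_congr rfl fun ⟨i, j⟩ hp => ?_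
  obtain rfl := mem_antidiagonal.1 hp
  have : ((i + j).choose i : ℝ) ≠ 0 := by
    exact_mod_cast (Nat.choose_pos (Nat.le_add_right i j)).ne'
  rw [integral_const_mul, integral_prod_bary_pow_mul_dirichletDensity hb, factorial_add,
    Fin.sum_univ_two b, Fin.sum_univ_two ![i, j],
    Fin.prod_univ_two (fun k => rising (b k) (![i, j] k))]
  simp only [Matrix.cons_val_zero, Matrix.cons_val_one, smul_eq_mul]
  field_simp

lemma integral_one_sub_rpow_mul_dirichletDensity {b : Fin 2 → ℝ} (hb : ∀ i, 0 < b i) (a : ℝ)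
    {ξ : Fin 2 → ℝ} (hξ : ∀ i, |ξ i| < 1) :
    ∫ t in simplexE 1, (1 - ∑ i, bary t i * ξ i) ^ (-a) * dirichletDensity b t
      = ∑' n, hyperRTerm a (b 0) (b 1) (ξ 0) (ξ 1) n := by
  set ρ := max |ξ 0| |ξ 1|
  have hρ : |ρ| < 1 := by
    rw [abs_of_nonneg (le_max_of_le_left (abs_nonneg _))]
    exact max_lt (hξ 0) (hξ 1)
  have hle {t : Fin 1 → ℝ} (ht : t ∈ simplexE 1) : |∑ i, bary t i * ξ i| ≤ |ρ| :=
    (norm_sum_bary_smul_le (ξ := ξ) ht (Fin.forall_fin_two.2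
      ⟨le_max_left |ξ 0| |ξ 1|, le_max_right |ξ 0| |ξ 1|⟩)).trans (le_abs_self ρ)
  have hbound (n : ℕ) (t) (ht : t ∈ simplexE 1) :
      |rising a n / n ! * (∑ i, bary t i * ξ i) ^ n| ≤ |rising a n / n ! * ρ ^ n| := by
    rw [abs_mul, abs_mul, abs_pow, abs_pow]
    exact mul_le_mul_of_nonneg_left (pow_le_pow_left₀ (abs_nonneg _) (hle ht) n) (abs_nonneg _)
  have hseries := hasSum_integral_mul_dirichletDensity hb (fun n => by fun_prop)
    (hasSum_rising_mul_pow a hρ).summable.abs hbound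
    fun t ht => hasSum_rising_mul_pow a ((hle ht).trans_lt hρ)
  simpa only [integral_sum_bary_mul_pow_two hb] using hseries.tsum_eq.symm

lemma dirichletAverage_rpow {a : ℝ} {b z : Fin 2 → ℝ} (hb : ∀ i, 0 < b i) (hz : ∀ i, 0 < z i)
    {l : ℝ} (hzl : ∀ i, z i < 2 * l) :
    dirichletAverage (fun u => u ^ (-a)) b z
      = l ^ (-a) * ∑' n, hyperRTerm a (b 0) (b 1) (1 - z 0 / l) (1 - z 1 / l) n := by
  have hl : 0 < l := by linarith [hz 0, hzl 0]
  have hξ (i) : |1 - z i / l| < 1 := abs_one_sub_div_lt_one (hz i) (hzl i)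
  rw [← integral_one_sub_rpow_mul_dirichletDensity hb a hξ, ← integral_const_mul, dirichletAverage]
  refine setIntegral_congr_fun (measurableSet_simplexE 1) fun t ht => ?_
  have hscale : ∑ i, bary t i * z i = l * (1 - ∑ i, bary t i * (1 - z i / l)) := by
    simp only [mul_sub, mul_one, Finset.sum_sub_distrib, sum_bary, sub_sub_cancel, Finset.mul_sum]
    exact Finset.sum_congr rfl fun i _ => by field_simp
  have hpos : 0 ≤ 1 - ∑ i, bary t i * (1 - z i / l) := by
    exact sub_nonneg.2 ((le_abs_self _).trans
      (norm_sum_bary_smul_le (ξ := fun i => 1 - z i / l) ht fun i => (hξ i).le))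
  simp only [hscale, Real.mul_rpow hl.le hpos, mul_assoc]

lemma isRContinuation_tsum_hyperRTerm (a : ℝ) {z : Fin 2 → ℝ} (hz : ∀ i, 0 < z i) {l : ℝ}
    (hzl : ∀ i, z i < 2 * l) :
    IsRContinuation a z (fun b => ((l ^ (-a) : ℝ) : ℂ) * ∑' n,
      hyperRTerm (a : ℂ) (b 0) (b 1) ((1 - z 0 / l : ℝ) : ℂ) ((1 - z 1 / l : ℝ) : ℂ) n) := by
  have hξ (i : Fin 2) : ‖((1 - z i / l : ℝ) : ℂ)‖ < 1 := by
    rw [Complex.norm_real]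
    exact abs_one_sub_div_lt_one (hz i) (hzl i)
  have hproj (b : Fin 2 → ℂ) (i : Fin 2) : AnalyticAt ℂ (fun b : Fin 2 → ℂ => b i) b :=
    (ContinuousLinearMap.proj i : (Fin 2 → ℂ) →L[ℂ] ℂ).analyticAt b
  refine ⟨fun b hb => analyticAt_const.mul ?_, fun b hb => ?_⟩
  · have hc (m : ℕ) : b 0 + b 1 ≠ -m := Fin.sum_univ_two b ▸ hb m
    exact (analyticOnNhd_tsum_hyperRTerm (a : ℂ) (hξ 0) (hξ 1) (b 0, b 1) hc).comp₂
      (hproj b 0) (hproj b 1)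
  · rw [dirichletAverage_rpow hb hz hzl]
    simp only [← ofReal_hyperRTerm, Complex.ofReal_mul, Complex.ofReal_tsum]

lemma isPreconnected_setOf_forall_add_mul_ne_neg_natCast {c : ℂ} (hc : ∀ m : ℕ, c ≠ -m) (d : ℂ) :
    IsPreconnected {w : ℂ | ∀ m : ℕ, c + w * d ≠ -m} := by
  have hcount : {w : ℂ | ∀ m : ℕ, c + w * d ≠ -m}ᶜ.Countable := by
    refine (Set.countable_range fun m : ℕ => (-(m : ℂ) - c) / d).mono fun w hw => ?_
    obtain ⟨m, hm⟩ := not_forall_not.1 hw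
    have hd : d ≠ 0 := by
      rintro rfl
      exact hc m (by simpa using hm)
    exact ⟨m, (div_eq_iff hd).2 (by rw [← hm, add_sub_cancel_left])⟩
  rw [← compl_compl {w : ℂ | _}]
  exact (hcount.isConnected_compl_of_one_lt_rank (by simp)).isPreconnected

lemma frequently_nhdsNE_of_eventually_ofReal {p : ℂ → Prop} {x : ℝ} (h : ∀ᶠ y : ℝ in 𝓝 x, p y) :
    ∃ᶠ w in 𝓝[≠] (x : ℂ), p w := by
  have hcoe : Tendsto (fun y : ℝ => (y : ℂ)) (𝓝[≠] x) (𝓝[≠] x) :=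
    Complex.continuous_ofReal.continuousWithinAt.tendsto_nhdsWithin fun y hy => by simpa using hy
  exact hcoe.frequently (h.filter_mono nhdsWithin_le_nhds).frequently

/- The identity theorem is applied on the complex line through `(1, …, 1)` and `b`, whose real
points near `(1, …, 1)` have positive entries. -/
lemma IsRContinuation.eq_ofReal {n : ℕ} {a : ℝ} {z : Fin (n + 1) → ℝ}
    {G₁ G₂ : (Fin (n + 1) → ℂ) → ℂ}
    (h₁ : IsRContinuation a z G₁) (h₂ : IsRContinuation a z G₂) {b : Fin (n + 1) → ℝ}
    (hc : ∀ m : ℕ, ∑ i, b i ≠ -m) : G₁ (fun i => (b i : ℂ)) = G₂ (fun i => (b i : ℂ)) := by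
  let line (w : ℂ) (i : Fin (n + 1)) : ℂ := 1 + w * (b i - 1)
  let c : ℂ := ∑ _i : Fin (n + 1), 1
  have hsum (w : ℂ) : ∑ i, line w i = c + w * ∑ i, ((b i : ℂ) - 1) := by
    simp only [line, c, Finset.sum_add_distrib, Finset.mul_sum]
  have hline1 : line 1 = fun i => (b i : ℂ) := by ext; simp [line]
  have hc0 (m : ℕ) : c ≠ -m := by
    intro h
    have : ((n : ℝ) + 1 : ℝ) = -m := by exact_mod_cast (by simpa [c] using h : (n : ℂ) + 1 = -m)
    linarith [n.cast_nonneg (α := ℝ), m.cast_nonneg (α := ℝ)]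
  have hanalytic {G : (Fin (n + 1) → ℂ) → ℂ} (hG : IsRContinuation a z G) :
      AnalyticOnNhd ℂ (fun w => G (line w)) {w | ∀ m : ℕ, c + w * ∑ i, ((b i : ℂ) - 1) ≠ -m} :=
    fun w hw => AnalyticAt.comp (g := G) (hG.1 _ (by simpa only [Set.mem_ofPred_eq, hsum] using hw))
      (.pi fun i => by fun_prop)
  have hreal : ∀ᶠ x : ℝ in 𝓝 0, G₁ (line x) = G₂ (line x) := by
    have hpos : ∀ᶠ x : ℝ in 𝓝 0, ∀ i, 0 < 1 + x * (b i - 1) :=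
      eventually_all.2 fun i => continuousAt_const.eventually_lt
        (Continuous.continuousAt (by fun_prop)) (by simp)
    filter_upwards [hpos] with x hx
    have hcast : line x = fun i => ((1 + x * (b i - 1) : ℝ) : ℂ) := by ext; simp [line]
    rw [hcast, h₁.2 _ hx, h₂.2 _ hx]
  have heq := AnalyticOnNhd.eqOn_of_preconnected_of_frequently_eq (hanalytic h₁) (hanalytic h₂)
    (isPreconnected_setOf_forall_add_mul_ne_neg_natCast hc0 _) (z₀ := 0) (by simpa using hc0)
    (by exact_mod_cast frequently_nhdsNE_of_eventually_ofReal hreal)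
  have hmem : (1 : ℂ) ∈ {w | ∀ m : ℕ, c + w * ∑ i, ((b i : ℂ) - 1) ≠ -m} := by
    intro m
    simp only [← hsum, hline1]
    exact_mod_cast hc m
  simpa only [hline1] using heq hmem

lemma hyperR_eq_tsum (a : ℝ) {b : Fin 2 → ℝ} (hc : ∀ m : ℕ, b 0 + b 1 ≠ -m) {z : Fin 2 → ℝ}
    (hz : ∀ i, 0 < z i) {l : ℝ} (hzl : ∀ i, z i < 2 * l) :
    hyperR a b z = l ^ (-a) * ∑' n, hyperRTerm a (b 0) (b 1) (1 - z 0 / l) (1 - z 1 / l) n := by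
  have hG := isRContinuation_tsum_hyperRTerm a hz hzl
  have hcont : IsRContinuation a z (Classical.epsilon (IsRContinuation a z)) :=
    Classical.epsilon_spec ⟨_, hG⟩
  rw [hyperR, hcont.eq_ofReal hG fun m => Fin.sum_univ_two b ▸ hc m,
    ← Complex.ofReal_re (l ^ (-a) * _)]
  simp only [← ofReal_hyperRTerm, Complex.ofReal_mul, Complex.ofReal_tsum]

lemma hyperR_eq_tsum_one (a : ℝ) {b : Fin 2 → ℝ} (hc : ∀ m : ℕ, b 0 + b 1 ≠ -m) {z : Fin 2 → ℝ}
    (hz : ∀ i, 0 < z i) (hz01 : z 0 < 2 * z 1) :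
    hyperR a b z = z 1 ^ (-a) * ∑' n, rising a n * rising (b 0) n /
      (rising (b 0 + b 1) n * n !) * (1 - z 0 / z 1) ^ n := by
  rw [hyperR_eq_tsum a hc hz (Fin.forall_fin_two.2 ⟨hz01, by linarith [hz 1]⟩)]
  congr 1
  simp only [div_self (hz 1).ne', sub_self, hyperRTerm_zero_right, smul_eq_mul]

lemma hyperR_self {b : Fin 2 → ℝ} (hc : ∀ m : ℕ, b 0 + b 1 ≠ -m) {z : Fin 2 → ℝ}
    (hz : ∀ i, 0 < z i) : hyperR (b 0 + b 1) b z = z 0 ^ (-b 0) * z 1 ^ (-b 1) := by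
  set l := z 0 + z 1
  have hz0 := hz 0
  have hz1 := hz 1
  have hl : 0 < l := add_pos hz0 hz1
  have hzl : ∀ i, z i < 2 * l := Fin.forall_fin_two.2 ⟨by linarith, by linarith⟩
  have hsum (i : Fin 2) := hasSum_rising_mul_pow (b i) (abs_one_sub_div_lt_one (hz i) (hzl i))
  have hprod := tsum_mul_tsum_eq_tsum_sum_antidiagonal_of_summable_norm (hsum 0).summable.norm
    (hsum 1).summable.norm
  have hterm (n : ℕ) : hyperRTerm (b 0 + b 1) (b 0) (b 1) (1 - z 0 / l) (1 - z 1 / l) n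
      = ∑ p ∈ antidiagonal n, rising (b 0) p.1 / p.1 ! * (1 - z 0 / l) ^ p.1 *
        (rising (b 1) p.2 / p.2 ! * (1 - z 1 / l) ^ p.2) := by
    rw [hyperRTerm, div_self (rising_ne_zero hc n)]
    exact Finset.sum_congr rfl fun p _ => by rw [smul_eq_mul]; ring
  rw [hyperR_eq_tsum _ hc hz hzl]
  simp_rw [hterm]
  rw [← hprod, (hsum 0).tsum_eq, (hsum 1).tsum_eq, sub_sub_cancel, sub_sub_cancel,
    Real.div_rpow hz0.le hl.le, Real.div_rpow hz1.le hl.le, neg_add, Real.rpow_add hl]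
  have := Real.rpow_pos_of_pos hl (-b 0)
  have := Real.rpow_pos_of_pos hl (-b 1)
  field_simp

end HyperR

section DoubleAverage

variable {n : ℕ}

instance : CompactSpace (simplexE n) := isCompact_iff_compactSpace.1 (isCompact_simplexE n)

instance : Nonempty (simplexE n) := ⟨0, by simp [simplexE]⟩

/-- The barycentric coordinate `t_j` as an element of the Banach algebra of continuous complex
functions on the simplex. -/
def baryMap (j : Fin (n + 1)) : C(simplexE n, ℂ) :=
  ⟨fun t => (bary (t : Fin n → ℝ) j : ℂ), by fun_prop⟩

/-- The affine function `t ↦ ∑ⱼ t_j c_j` on the simplex, with value `c_j` at the `j`-th vertex. -/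
def simplexAffine (c : Fin (n + 1) → ℂ) : C(simplexE n, ℂ) := ∑ j, c j • baryMap j

lemma simplexAffine_apply (c : Fin (n + 1) → ℂ) (t : simplexE n) :
    simplexAffine c t = ∑ j, bary (t : Fin n → ℝ) j • c j := by
  simp only [simplexAffine, ContinuousMap.sum_apply, ContinuousMap.smul_apply, smul_eq_mul, baryMap,
    ContinuousMap.coe_mk, Complex.real_smul, mul_comm]

lemma norm_simplexAffine_le {c : Fin (n + 1) → ℂ} {ρ : ℝ} (hc : ∀ j, ‖c j‖ ≤ ρ) :
    ‖simplexAffine c‖ ≤ ρ := by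
  refine (ContinuousMap.norm_le _ ((norm_nonneg _).trans (hc 0))).2 fun t => ?_
  rw [simplexAffine_apply]
  exact norm_sum_bary_smul_le t.2 hc

/-- The value at `t` of `l ^ a R_{-a}(b₀, b₁; ·)`, expanded in powers of `1 - z_i / l`, where
`1 - z_i / l` is the affine function on the simplex with values `c i j` at the vertices. -/
def hyperRSeries (a b₀ b₁ : ℂ) (c : Fin 2 → Fin (n + 1) → ℂ) (t : Fin n → ℝ) : ℂ :=
  ∑' k, hyperRTerm a b₀ b₁ (∑ j, bary t j • c 0 j) (∑ j, bary t j • c 1 j) k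

/-- The series `hyperRSeries`, summed in the Banach algebra of continuous functions on the
simplex. -/
def hyperRMap (a b₀ b₁ : ℂ) (c : Fin 2 → Fin (n + 1) → ℂ) : C(simplexE n, ℂ) :=
  ∑' k, hyperRTerm a b₀ b₁ (simplexAffine (c 0)) (simplexAffine (c 1)) k

lemma exists_lt_one_forall_norm_lt {c : Fin 2 → Fin (n + 1) → ℂ} (hc : ∀ i j, ‖c i j‖ < 1) :
    ∃ ρ < 1, ∀ i j, ‖c i j‖ < ρ := by
  have hev : ∀ᶠ ρ in 𝓝[<] (1 : ℝ), ∀ i j, ‖c i j‖ < ρ :=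
    eventually_all.2 fun i => eventually_all.2 fun j => nhdsWithin_le_nhds (lt_mem_nhds (hc i j))
  obtain ⟨ρ, hcρ, hρ⟩ := (hev.and self_mem_nhdsWithin).exists
  exact ⟨ρ, hρ, hcρ⟩

lemma exists_summable_norm_hyperRTerm_simplexAffine_le (a : ℂ) {b₀ b₁ : ℂ}
    (hb : ∀ m : ℕ, b₀ + b₁ ≠ -m) {c₀ : Fin 2 → Fin (n + 1) → ℂ} (hc₀ : ∀ i j, ‖c₀ i j‖ < 1) :
    ∃ u : ℕ → ℝ, Summable u ∧ ∀ᶠ c in 𝓝 c₀, ∀ k,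
      ‖hyperRTerm a b₀ b₁ (simplexAffine (c 0)) (simplexAffine (c 1)) k‖ ≤ u k := by
  obtain ⟨ρ, hρ, hcρ⟩ := exists_lt_one_forall_norm_lt hc₀
  obtain ⟨u, hu, hle⟩ := exists_summable_norm_hyperRTerm_le (A := C(simplexE n, ℂ)) a hb
    ((norm_nonneg _).trans (hcρ 0 0).le) hρ
  have hev : ∀ᶠ c in 𝓝 c₀, ∀ i j, ‖c i j‖ < ρ := eventually_all.2 fun i => eventually_all.2 fun j =>
    (by fun_prop : Continuous fun c : Fin 2 → Fin (n + 1) → ℂ => ‖c i j‖).continuousAt.eventually_lt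
      continuousAt_const (hcρ i j)
  refine ⟨u, hu, hev.mono fun c hc k => hle.self_of_nhds k _ _ ?_ ?_⟩ <;>
    exact norm_simplexAffine_le fun j => (hc _ j).le

lemma hyperRMap_apply (a : ℂ) {b₀ b₁ : ℂ} (hb : ∀ m : ℕ, b₀ + b₁ ≠ -m)
    {c : Fin 2 → Fin (n + 1) → ℂ} (hc : ∀ i j, ‖c i j‖ < 1) (t : simplexE n) :
    hyperRMap a b₀ b₁ c t = hyperRSeries a b₀ b₁ c t := by
  obtain ⟨u, hu, hle⟩ := exists_summable_norm_hyperRTerm_simplexAffine_le a hb hc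
  have hsum : Summable (hyperRTerm a b₀ b₁ (simplexAffine (c 0)) (simplexAffine (c 1))) :=
    .of_norm_bounded hu hle.self_of_nhds
  have heval (k : ℕ) := map_hyperRTerm (ContinuousMap.evalAlgHom ℂ ℂ t) a b₀ b₁
    (simplexAffine (c 0)) (simplexAffine (c 1)) k
  simp only [ContinuousMap.evalAlgHom_apply, simplexAffine_apply] at heval
  rw [hyperRMap, ← ContinuousMap.tsum_apply hsum, hyperRSeries]
  exact tsum_congr heval

lemma isOpen_setOf_forall_norm_lt_one {V : Type*} [TopologicalSpace V]
    {c : V → Fin 2 → Fin (n + 1) → ℂ} (hc : Continuous c) :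
    IsOpen {v | ∀ i j, ‖c v i j‖ < 1} := by
  simp only [Set.ofPred_forall]
  exact isOpen_iInter_of_finite fun i => isOpen_iInter_of_finite fun j =>
    isOpen_lt (by fun_prop) continuous_const

lemma analyticOnNhd_hyperRMap (a : ℂ) {b₀ b₁ : ℂ} (hb : ∀ m : ℕ, b₀ + b₁ ≠ -m)
    {c : ℂ × ℂ → Fin 2 → Fin (n + 1) → ℂ} (hc : ∀ p i j, AnalyticAt ℂ (fun p => c p i j) p) :
    AnalyticOnNhd ℂ (fun p => hyperRMap a b₀ b₁ (c p)) {p | ∀ i j, ‖c p i j‖ < 1} := by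
  have hcont : Continuous c := continuous_pi fun i => continuous_pi fun j =>
    continuous_iff_continuousAt.2 fun p => (hc p i j).continuousAt
  have haffine (i : Fin 2) (p : ℂ × ℂ) : AnalyticAt ℂ (fun p => simplexAffine (c p i)) p :=
    Finset.analyticAt_fun_sum _ fun j _ => (hc p i j).fun_smul analyticAt_const
  refine analyticOnNhd_tsum (isOpen_setOf_forall_norm_lt_one hcont) (fun k p _ => ?_) fun p hp => ?_
  · exact Finset.analyticAt_fun_sum _ fun q _ => analyticAt_const.fun_smul
      (((haffine 0 p).fun_pow _).fun_mul ((haffine 1 p).fun_pow _))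
  · obtain ⟨u, hu, hle⟩ := exists_summable_norm_hyperRTerm_simplexAffine_le a hb hp
    exact ⟨_, hcont.continuousAt.eventually hle, u, hu, fun q hq => hq⟩

lemma hyperR_mulVec_bary (a : ℝ) {b : Fin 2 → ℝ} (hb : ∀ m : ℕ, b 0 + b 1 ≠ -m)
    {X : Matrix (Fin 2) (Fin (n + 1)) ℝ} (hX : ∀ i j, 0 < X i j) {l : ℝ}
    (hXl : ∀ i j, X i j < 2 * l) {t : Fin n → ℝ} (ht : t ∈ simplexE n) :
    (hyperR a b (X *ᵥ bary t) : ℂ)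
      = (l ^ (-a) : ℝ) * hyperRSeries a (b 0) (b 1) (fun i j => 1 - X i j / l) t := by
  have hmem (i : Fin 2) : (X *ᵥ bary t) i ∈ Set.Ioo 0 (2 * l) := by
    have := (convex_Ioo (0 : ℝ) (2 * l)).sum_mem (fun j _ => bary_nonneg ht j) (sum_bary t)
      fun j _ => ⟨hX i j, hXl i j⟩
    simpa only [Matrix.mulVec, dotProduct, smul_eq_mul, mul_comm] using this
  have hscale (i : Fin 2) : ((1 - (X *ᵥ bary t) i / l : ℝ) : ℂ)
      = ∑ j, bary t j • (1 - X i j / l : ℂ) := by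
    have hreal : 1 - (X *ᵥ bary t) i / l
        = ∑ j, bary t j * (1 - X i j / l) := by
      simp only [Matrix.mulVec, dotProduct, mul_sub, mul_one, Finset.sum_sub_distrib, sum_bary,
        Finset.sum_div]
      exact congrArg (1 - ·) (Finset.sum_congr rfl fun j _ => by ring)
    rw [hreal]
    push_cast [Complex.real_smul]
    rfl
  rw [hyperRSeries, ← hscale, ← hscale, hyperR_eq_tsum a hb (fun i => (hmem i).1)
    fun i => (hmem i).2]
  simp only [← ofReal_hyperRTerm, Complex.ofReal_mul, Complex.ofReal_tsum]

/-- The double Dirichlet average `∫ R_{-a}(b; X t) φ_d(t) dt` over the simplex. -/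
def doubleAverage (a : ℝ) (b : Fin 2 → ℝ) (d : Fin (n + 1) → ℝ)
    (X : Matrix (Fin 2) (Fin (n + 1)) ℝ) : ℝ :=
  ∫ t in simplexE n, hyperR a b (X *ᵥ bary t) * dirichletDensity d t

lemma exists_forall_lt_two_mul (X : Matrix (Fin 2) (Fin (n + 1)) ℝ) :
    ∃ l : ℝ, ∀ i j, X i j < 2 * l := by
  obtain ⟨M, hM⟩ := Finite.bddAbove_range fun p : Fin 2 × Fin (n + 1) => X p.1 p.2
  exact ⟨(M + 1) / 2, fun i j => by linarith [hM ⟨(i, j), rfl⟩]⟩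

lemma norm_one_sub_div_lt_one {X : Matrix (Fin 2) (Fin (n + 1)) ℝ} (hX : ∀ i j, 0 < X i j) {l : ℝ}
    (hXl : ∀ i j, X i j < 2 * l) (i : Fin 2) (j : Fin (n + 1)) : ‖(1 - X i j / l : ℂ)‖ < 1 := by
  exact_mod_cast abs_one_sub_div_lt_one (hX i j) (hXl i j)

lemma continuousOn_hyperR_mulVec_bary (a : ℝ) {b : Fin 2 → ℝ} (hb : ∀ m : ℕ, b 0 + b 1 ≠ -m)
    {X : Matrix (Fin 2) (Fin (n + 1)) ℝ} (hX : ∀ i j, 0 < X i j) :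
    ContinuousOn (fun t => hyperR a b (X *ᵥ bary t)) (simplexE n) := by
  obtain ⟨l, hXl⟩ := exists_forall_lt_two_mul X
  have hre (t : simplexE n) : ((l ^ (-a) : ℝ) *
        hyperRMap (a : ℂ) (b 0) (b 1) (fun i j => 1 - X i j / l) t).re
      = hyperR a b (X *ᵥ bary (t : Fin n → ℝ)) := by
    rw [hyperRMap_apply _ (by exact_mod_cast hb) (norm_one_sub_div_lt_one hX hXl),
      ← hyperR_mulVec_bary a hb hX hXl t.2, Complex.ofReal_re]
  rw [continuousOn_iff_continuous_domRestrict]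
  exact (by fun_prop : Continuous fun t => ((l ^ (-a) : ℝ) *
    hyperRMap (a : ℂ) (b 0) (b 1) (fun i j => 1 - X i j / l) t).re).congr hre

lemma ofReal_doubleAverage (a : ℝ) {b : Fin 2 → ℝ} (hb : ∀ m : ℕ, b 0 + b 1 ≠ -m)
    (d : Fin (n + 1) → ℝ) {X : Matrix (Fin 2) (Fin (n + 1)) ℝ} (hX : ∀ i j, 0 < X i j) {l : ℝ}
    (hXl : ∀ i j, X i j < 2 * l) :
    (doubleAverage a b d X : ℂ) = (l ^ (-a) : ℝ) * ∫ t in simplexE n,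
      hyperRSeries a (b 0) (b 1) (fun i j => 1 - X i j / l) t • (dirichletDensity d t : ℂ) := by
  rw [doubleAverage, ← integral_const_mul]
  refine integral_ofReal.symm.trans (setIntegral_congr_fun (measurableSet_simplexE n)
    fun t ht => ?_)
  simp only [Complex.coe_algebraMap, Complex.ofReal_mul, hyperR_mulVec_bary a hb hX hXl ht,
    smul_eq_mul, mul_assoc]

lemma pos_and_lt_two_mul_of_abs_one_sub_div_lt_one {z l : ℝ} (hl : 0 < l)
    (hz : |1 - z / l| < 1) : 0 < z ∧ z < 2 * l := by
  obtain ⟨hlower, hupper⟩ := abs_lt.1 hz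
  exact ⟨(div_pos_iff_of_pos_right hl).1 (by linarith), (div_lt_iff₀ hl).1 (by linarith)⟩

lemma analyticAt_doubleAverage (a : ℝ) {b : Fin 2 → ℝ} (hb : ∀ m : ℕ, b 0 + b 1 ≠ -m)
    {d : Fin (n + 1) → ℝ} (hd : ∀ i, 0 < d i) {Z : ℂ × ℂ → Fin 2 → Fin (n + 1) → ℂ}
    (hZ : ∀ p i j, AnalyticAt ℂ (fun p => Z p i j) p)
    {X : ℝ × ℝ → Matrix (Fin 2) (Fin (n + 1)) ℝ}
    (hZX : ∀ (x : ℝ × ℝ) i j, Z (x.1, x.2) i j = X x i j) {x : ℝ × ℝ} (hX : ∀ i j, 0 < X x i j) :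
    AnalyticAt ℝ (fun x => doubleAverage a b d (X x)) x := by
  obtain ⟨l, hXl⟩ := exists_forall_lt_two_mul (X x)
  have hl : 0 < l := by linarith [hX 0 0, hXl 0 0]
  set c : ℂ × ℂ → Fin 2 → Fin (n + 1) → ℂ := fun p i j => 1 - Z p i j / l
  let emb : ℝ × ℝ →L[ℝ] ℂ × ℂ := Complex.ofRealCLM.prodMap Complex.ofRealCLM
  have hcX (y : ℝ × ℝ) : c (emb y) = fun i j => (1 - X y i j / l : ℂ) :=
    funext₂ fun i j => congrArg (1 - · / (l : ℂ)) (hZX y i j)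
  have hc (p i j) : AnalyticAt ℂ (fun p => c p i j) p :=
    analyticAt_const.fun_sub ((hZ p i j).fun_div analyticAt_const (by exact_mod_cast hl.ne'))
  have hcont : Continuous c := continuous_pi fun i => continuous_pi fun j =>
    continuous_iff_continuousAt.2 fun p => (hc p i j).continuousAt
  have hb' (m : ℕ) : (b 0 + b 1 : ℂ) ≠ -m := by exact_mod_cast hb m
  have hmem : emb x ∈ {p | ∀ i j, ‖c p i j‖ < 1} := by
    simpa only [Set.mem_ofPred_eq, hcX] using norm_one_sub_div_lt_one hX hXl
  have hnhds : ∀ᶠ p in 𝓝 (emb x), ∀ i j, ‖c p i j‖ < 1 :=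
    (isOpen_setOf_forall_norm_lt_one hcont).mem_nhds hmem
  have hdensity : IntegrableOn (fun t => (dirichletDensity d t : ℂ)) (simplexE n) :=
    (integrableOn_dirichletDensity hd).ofReal
  have hanalytic : AnalyticAt ℂ (fun p => ∫ t in simplexE n,
      hyperRSeries a (b 0) (b 1) (c p) t • (dirichletDensity d t : ℂ)) (emb x) :=
    analyticAt_setIntegral_smul (measurableSet_simplexE n)
      hdensity (analyticOnNhd_hyperRMap a hb' hc _ hmem)
      (hnhds.mono fun p hp => hyperRMap_apply a hb' hp)
  have hscaled := (analyticAt_const (v := ((l ^ (-a) : ℝ) : ℂ))).mul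
    ((hanalytic.restrictScalars (𝕜 := ℝ)).comp (emb.analyticAt x))
  refine ((Complex.reCLM.analyticAt _).comp hscaled).congr ?_
  filter_upwards [emb.continuous.continuousAt.eventually hnhds] with y hy
  have hXy (i j) : 0 < X y i j ∧ X y i j < 2 * l :=
    pos_and_lt_two_mul_of_abs_one_sub_div_lt_one hl <| by
      have hnorm : ‖(1 - X y i j / l : ℂ)‖ < 1 := by simpa only [hcX] using hy i j
      exact_mod_cast hnorm
  simp only [Function.comp_def, hcX]
  exact (congrArg Complex.re (ofReal_doubleAverage a hb d (fun i j => (hXy i j).1)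
    fun i j => (hXy i j).2)).symm

end DoubleAverage

section KnotExpansion

/-- The coefficient of `u ^ k` in Gauss's hypergeometric series `₂F₁(α, β; γ; u)`. -/
def gaussCoeff (α β γ : ℝ) (k : ℕ) : ℝ := rising α k * rising β k / (rising γ k * k !)

lemma summable_abs_gaussCoeff_mul_pow (α β : ℝ) {γ u : ℝ} (hγ : ∀ m : ℕ, γ ≠ -m) (hu0 : 0 ≤ u)
    (hu : u < 1) : Summable fun k => |gaussCoeff α β γ k| * u ^ k := by
  have hc (m : ℕ) : (β : ℂ) + (γ - β : ℝ) ≠ -m := by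
    rw [← Complex.ofReal_add, add_sub_cancel]
    exact_mod_cast hγ m
  obtain ⟨w, hw, hle⟩ := exists_summable_norm_hyperRTerm_le (A := ℂ) α hc hu0 hu
  refine .of_nonneg_of_le (fun k => by positivity) (fun k => ?_) hw
  have hbound := hle.self_of_nhds k u 0 (by simp [abs_of_nonneg hu0]) (by simpa using hu0)
  rw [← Complex.ofReal_zero, ← ofReal_hyperRTerm, Complex.norm_real, hyperRTerm_zero_right,
    add_sub_cancel, norm_smul, norm_pow, Real.norm_of_nonneg hu0] at hbound
  exact hbound

lemma hasSum_choose_mul_pow_mul_rising_mul_pow (a u : ℝ) {v : ℝ} (hv : |v| < 1) (k : ℕ) :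
    HasSum (fun w : ℕ × ℕ =>
        k.choose w.1 * u ^ w.1 * (rising (a + k) w.2 / w.2 ! * v ^ w.2))
      ((1 - v) ^ (-a) * ((1 + u) / (1 - v)) ^ k) := by
  have hchoose := hasSum_choose_mul_pow k u
  have hrising := hasSum_rising_mul_pow (a + k) hv
  have hpos : 0 < 1 - v := by linarith [(abs_lt.1 hv).2]
  have hpow : (1 - v) ^ (-a) * ((1 + u) / (1 - v)) ^ k = (1 + u) ^ k * (1 - v) ^ (-(a + k)) := by
    rw [neg_add, Real.rpow_add hpos, Real.rpow_neg hpos.le (k : ℝ), Real.rpow_natCast, div_pow]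
    ring
  have hmul := summable_mul_of_summable_norm hchoose.summable.norm hrising.summable.norm
  rw [hpow]
  exact HasSum.mul hchoose hrising hmul

/-- The term of index `(k, (q, l))` of the expansion of
`(1 - v) ^ (-α) * ₂F₁(α, β; γ; x * (1 - u) / (1 - v))` in powers of `x`, `u` and `v`. -/
def gaussTerm (α β γ x u v : ℝ) (y : ℕ × (ℕ × ℕ)) : ℝ :=
  gaussCoeff α β γ y.1 * x ^ y.1 *
    (y.1.choose y.2.1 * (-u) ^ y.2.1 * (rising (α + y.1) y.2.2 / y.2.2 ! * v ^ y.2.2))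

lemma hasSum_gaussTerm_fiber (α β γ x u : ℝ) {v : ℝ} (hv : |v| < 1) (k : ℕ) :
    HasSum (fun w => gaussTerm α β γ x u v (k, w))
      ((1 - v) ^ (-α) * (gaussCoeff α β γ k * (x * (1 - u) / (1 - v)) ^ k)) := by
  have h := (hasSum_choose_mul_pow_mul_rising_mul_pow α (-u) hv k).mul_left
    (gaussCoeff α β γ k * x ^ k)
  convert! h using 1
  rw [← sub_eq_add_neg, mul_div_assoc, mul_pow]
  ring

lemma summable_gaussTerm (α β : ℝ) {γ x u v : ℝ} (hγ : ∀ m : ℕ, γ ≠ -m)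
    (h : |x| * (1 + |u|) + |v| < 1) : Summable (gaussTerm α β γ x u v) := by
  have hv : |(|v|)| < 1 := by
    rw [abs_abs]
    linarith [(by positivity : 0 ≤ |x| * (1 + |u|))]
  have hpos : 0 < 1 - |v| := by linarith [abs_abs v]
  have hratio : |x| * (1 + |u|) / (1 - |v|) < 1 := (div_lt_one hpos).2 (by linarith)
  have hfiber (k : ℕ) := (hasSum_choose_mul_pow_mul_rising_mul_pow |α| |u| hv k).mul_left
    (|gaussCoeff α β γ k| * |x| ^ k)
  refine .of_norm_bounded (g := fun y : ℕ × (ℕ × ℕ) => |gaussCoeff α β γ y.1| * |x| ^ y.1 *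
    (y.1.choose y.2.1 * |u| ^ y.2.1 * (rising (|α| + y.1) y.2.2 / y.2.2 ! * |v| ^ y.2.2)))
    ((summable_prod_of_nonneg fun y => ?_).2 ⟨fun k => (hfiber k).summable, ?_⟩) fun y => ?_
  · have := rising_nonneg (by positivity : 0 ≤ |α| + y.1) y.2.2
    simp only [Pi.zero_apply]
    positivity
  · refine ((summable_abs_gaussCoeff_mul_pow α β hγ (by positivity) hratio).mul_left
      ((1 - |v|) ^ (-|α|))).congr fun k => ?_
    rw [(hfiber k).tsum_eq, mul_div_assoc, mul_pow]
    ring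
  · have hrising := norm_rising_le (a := α + y.1) (A := |α| + y.1)
      ((norm_add_le _ _).trans (by simp)) y.2.2
    rw [Real.norm_eq_abs] at hrising
    simp only [gaussTerm, Real.norm_eq_abs, abs_mul, abs_div, abs_pow, abs_neg, Nat.abs_cast]
    gcongr

lemma hasSum_gaussTerm (α β : ℝ) {γ x u v : ℝ} (hγ : ∀ m : ℕ, γ ≠ -m)
    (h : |x| * (1 + |u|) + |v| < 1) :
    HasSum (gaussTerm α β γ x u v)
      ((1 - v) ^ (-α) * ∑' k, gaussCoeff α β γ k * (x * (1 - u) / (1 - v)) ^ k) := by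
  have hv : |v| < 1 := by linarith [(by positivity : 0 ≤ |x| * (1 + |u|))]
  have hsum := (summable_gaussTerm α β hγ h).hasSum
  rwa [← (hsum.prod_fiberwise (hasSum_gaussTerm_fiber α β γ x u hv)).tsum_eq, tsum_mul_left]
    at hsum

lemma knots_mulVec_bary_one (x₁ x₂ : ℝ) (t : Fin 2 → ℝ) :
    (knots x₁ x₂ *ᵥ bary t) 1 = 1 - x₂ * (bary t 0 + bary t 1) := by
  have hsum := (Fin.sum_univ_three (bary t)).symm.trans (sum_bary t)
  refine (Fin.sum_univ_three fun j => knots x₁ x₂ _ j * bary t j).trans ?_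
  simp only [knots, Matrix.of_apply, Matrix.cons_val]
  linear_combination hsum

lemma knots_mulVec_bary_zero (x₁ x₂ : ℝ) (t : Fin 2 → ℝ) :
    (knots x₁ x₂ *ᵥ bary t) 0 = 1 - x₂ * (bary t 0 + bary t 1) - x₁ * (1 - x₂ * bary t 0) := by
  have hsum := (Fin.sum_univ_three (bary t)).symm.trans (sum_bary t)
  refine (Fin.sum_univ_three fun j => knots x₁ x₂ _ j * bary t j).trans ?_
  simp only [knots, Matrix.of_apply, Matrix.cons_val]
  linear_combination (1 - x₁) * hsum

lemma bary_zero_le_add_le_one {t : Fin 2 → ℝ} (ht : t ∈ simplexE 2) :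
    0 ≤ bary t 0 ∧ bary t 0 ≤ bary t 0 + bary t 1 ∧ bary t 0 + bary t 1 ≤ 1 := by
  have hsum := (Fin.sum_univ_three (bary t)).symm.trans (sum_bary t)
  exact ⟨bary_nonneg ht 0, by linarith [bary_nonneg ht 1], by linarith [bary_nonneg ht 2]⟩

lemma abs_mul_add_abs_lt_one {x₁ x₂ : ℝ} (h : √(|x₁| * (1 + |x₂|)) + √(|x₂| * (1 + |x₁|)) < 1) :
    |x₁| * (1 + |x₂|) + |x₂| < 1 := by
  have hsq₁ := Real.sq_sqrt (by positivity : 0 ≤ |x₁| * (1 + |x₂|))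
  have hsq₂ := Real.sq_sqrt (by positivity : 0 ≤ |x₂| * (1 + |x₁|))
  nlinarith [Real.sqrt_nonneg (|x₁| * (1 + |x₂|)), Real.sqrt_nonneg (|x₂| * (1 + |x₁|)),
    abs_nonneg x₁, abs_nonneg x₂, mul_nonneg (abs_nonneg x₁) (abs_nonneg x₂)]

lemma hasSum_hyperR_knots (α β : ℝ) {γ x₁ x₂ : ℝ} (hγ : ∀ m : ℕ, γ ≠ -m)
    (h : |x₁| * (1 + |x₂|) + |x₂| < 1) {t : Fin 2 → ℝ} (ht : t ∈ simplexE 2) :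
    HasSum (fun y : ℕ × (ℕ × ℕ) => gaussTerm α β γ x₁ x₂ x₂ y *
        (bary t 0 ^ y.2.1 * (bary t 0 + bary t 1) ^ y.2.2))
      (hyperR α ![β, γ - β] (knots x₁ x₂ *ᵥ bary t)) := by
  have hz₀ := knots_mulVec_bary_zero x₁ x₂ t
  have hz₁ := knots_mulVec_bary_one x₁ x₂ t
  obtain ⟨hs0, hsw, hw1⟩ := bary_zero_le_add_le_one ht
  set s := bary t 0
  set w := s + bary t 1
  have hw : |x₂ * w| ≤ |x₂| := by
    simpa only [abs_mul, abs_of_nonneg (hs0.trans hsw)] using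
      mul_le_of_le_one_right (abs_nonneg x₂) hw1
  have hs : |x₂ * s| ≤ |x₂| := by
    simpa only [abs_mul, abs_of_nonneg hs0] using
      mul_le_of_le_one_right (abs_nonneg x₂) (hsw.trans hw1)
  have hlt : |x₁| * (1 + |x₂ * s|) + |x₂ * w| < 1 := lt_of_le_of_lt (by gcongr) h
  have hdiff : |x₁ * (1 - x₂ * s)| < 1 - x₂ * w := by
    have hone : |1 - x₂ * s| ≤ 1 + |x₂ * s| := (abs_sub _ _).trans_eq (by rw [abs_one])
    calc |x₁ * (1 - x₂ * s)| ≤ |x₁| * (1 + |x₂ * s|) := by rw [abs_mul]; gcongr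
      _ < 1 - x₂ * w := by linarith [le_abs_self (x₂ * w)]
  obtain ⟨hlower, hupper⟩ := abs_lt.1 hdiff
  have hpos : 0 < 1 - x₂ * w := (abs_nonneg _).trans_lt hdiff
  have hratio : 1 - (1 - x₂ * w - x₁ * (1 - x₂ * s)) / (1 - x₂ * w)
      = x₁ * (1 - x₂ * s) / (1 - x₂ * w) := by
    field_simp
    ring
  have hvalue : hyperR α ![β, γ - β] (knots x₁ x₂ *ᵥ bary t) = (1 - x₂ * w) ^ (-α) *
      ∑' k, gaussCoeff α β γ k * (x₁ * (1 - x₂ * s) / (1 - x₂ * w)) ^ k := by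
    rw [hyperR_eq_tsum_one α (by simpa using hγ) (Fin.forall_fin_two.2 ⟨?_, ?_⟩) ?_, hz₀, hz₁,
      hratio]
    · simp only [Matrix.cons_val, add_sub_cancel, gaussCoeff]
    all_goals linarith
  rw [hvalue]
  refine (hasSum_gaussTerm α β hγ hlt).congr_fun fun y => ?_
  simp only [gaussTerm, ← neg_mul, mul_pow]
  ring

lemma integral_bary_zero_pow_mul_dirichletDensity {d : Fin 3 → ℝ} (hd : ∀ i, 0 < d i) (q l : ℕ) :
    ∫ t in simplexE 2, bary t 0 ^ q * (bary t 0 + bary t 1) ^ l * dirichletDensity d t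
      = rising (d 0) q * rising (d 0 + d 1 + q) l / rising (d 0 + d 1 + d 2) (q + l) := by
  have hexpand (t : Fin 2 → ℝ) :
      bary t 0 ^ q * (bary t 0 + bary t 1) ^ l * dirichletDensity d t
        = ∑ p ∈ antidiagonal l, (l.choose p.1 : ℝ) *
          ((∏ i, bary t i ^ (![q + p.1, p.2, 0] : Fin 3 → ℕ) i) * dirichletDensity d t) := by
    rw [(Commute.all _ _).add_pow', Finset.mul_sum, Finset.sum_mul]
    refine Finset.sum_congr rfl fun p _ => ?_
    rw [Fin.prod_univ_three]
    simp only [Matrix.cons_val, pow_zero, nsmul_eq_mul, pow_add]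
    ring
  have hint (p : ℕ × ℕ) : IntegrableOn (fun t =>
      (∏ i, bary t i ^ (![q + p.1, p.2, 0] : Fin 3 → ℕ) i) * dirichletDensity d t)
        (simplexE 2) :=
    integrableOn_mul_dirichletDensity hd (by fun_prop)
  have hshift : rising (d 0 + d 1 + q) l = rising (d 0 + q + d 1) l := by rw [add_right_comm]
  simp only [hexpand]
  rw [integral_finsetSum _ fun p _ => (hint p).const_mul _, hshift,
    ← sum_choose_mul_rising_mul_rising, Finset.mul_sum, Finset.sum_div]
  refine Finset.sum_congr rfl fun p hp => ?_
  rw [integral_const_mul, integral_prod_bary_pow_mul_dirichletDensity hd, Fin.prod_univ_three,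
    Fin.sum_univ_three, Fin.sum_univ_three]
  simp only [Matrix.cons_val, rising_zero, rising_add, add_zero, add_assoc, mem_antidiagonal.1 hp]
  ring

lemma hasSum_doubleAverage_knots (α β : ℝ) {γ x₁ x₂ : ℝ} (hγ : ∀ m : ℕ, γ ≠ -m)
    (h : |x₁| * (1 + |x₂|) + |x₂| < 1) {d : Fin 3 → ℝ} (hd : ∀ i, 0 < d i) :
    HasSum (fun y : ℕ × (ℕ × ℕ) => gaussTerm α β γ x₁ x₂ x₂ y * (rising (d 0) y.2.1 *
        rising (d 0 + d 1 + y.2.1) y.2.2 / rising (d 0 + d 1 + d 2) (y.2.1 + y.2.2)))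
      (doubleAverage α ![β, γ - β] d (knots x₁ x₂)) := by
  have hsum := hasSum_integral_mul_dirichletDensity hd (f := fun y t => gaussTerm α β γ x₁ x₂ x₂ y *
    (bary t 0 ^ y.2.1 * (bary t 0 + bary t 1) ^ y.2.2)) (fun y => by fun_prop)
    (summable_gaussTerm α β hγ h).norm (fun y t ht => ?_)
    fun t ht => hasSum_hyperR_knots α β hγ h ht
  · simpa only [doubleAverage, mul_assoc (gaussTerm α β γ x₁ x₂ x₂ _), integral_const_mul,
      integral_bary_zero_pow_mul_dirichletDensity hd] using hsum
  · obtain ⟨hs0, hsw, hw1⟩ := bary_zero_le_add_le_one ht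
    have hw0 := hs0.trans hsw
    rw [abs_mul, abs_of_nonneg (a := bary t 0 ^ y.2.1 * _) (by positivity)]
    exact mul_le_of_le_one_right (abs_nonneg _) <|
      mul_le_one₀ (pow_le_one₀ hs0 (hsw.trans hw1)) (by positivity) (pow_le_one₀ hw0 hw1)

lemma appellKnotTerm_eq_mul {α β γ δ : ℝ} (x₁ x₂ : ℝ) (hγ : ∀ m : ℕ, γ ≠ -m)
    (hδ : ∀ m : ℕ, δ ≠ -m) (k q l : ℕ) :
    appellKnotTerm α β γ δ x₁ x₂ (k, (q, l)) =
      x₁ ^ k * x₂ ^ (q + l) / (rising γ k * rising δ (q + l) * k ! * (q + l)!) *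
        ((q + l).choose q * (k.descFactorial q * (-1) ^ q *
          (rising α (k + l) * rising β (k + l) *
            rising (γ + δ - α - 1 + (α + ↑(k + l))) q))) := by
  have := rising_ne_zero hγ k
  have := rising_ne_zero hδ (q + l)
  have : ((q + l).choose q : ℝ) ≠ 0 := by
    exact_mod_cast (Nat.choose_pos (Nat.le_add_right q l)).ne'
  have hparam : γ + δ - α - 1 + (α + ↑(k + l)) = γ + δ - 1 + ↑(k + l) := by ring
  rw [appellKnotTerm, hparam, factorial_add]
  field_simp

lemma gaussTerm_mul_eq_mul {α β γ δ : ℝ} (x₁ x₂ : ℝ) (hγ : ∀ m : ℕ, γ ≠ -m)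
    (hδ : ∀ m : ℕ, δ ≠ -m) (k q l : ℕ) :
    gaussTerm α β γ x₁ x₂ x₂ (k, (q, l)) *
        (rising (γ + δ - α - 1) q * rising (β + q) l / rising δ (q + l)) =
      x₁ ^ k * x₂ ^ (q + l) / (rising γ k * rising δ (q + l) * k ! * (q + l)!) *
        ((q + l).choose q * (k.descFactorial q * (-1) ^ q *
          (rising α (k + l) * rising (γ + δ - α - 1) q * rising β k * rising (β + q) l))) := by
  have := rising_ne_zero hγ k
  have := rising_ne_zero hδ (q + l)
  have : ((q + l).choose q : ℝ) ≠ 0 := by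
    exact_mod_cast (Nat.choose_pos (Nat.le_add_right q l)).ne'
  rw [gaussTerm, gaussCoeff, Nat.descFactorial_eq_factorial_mul_choose, rising_add α k,
    factorial_add, neg_pow, pow_add x₂, Nat.cast_mul]
  dsimp only
  field_simp

lemma sum_appellKnotTerm {α β γ δ : ℝ} (x₁ x₂ : ℝ) (hγ : ∀ m : ℕ, γ ≠ -m) (hδ : ∀ m : ℕ, δ ≠ -m)
    (k m : ℕ) :
    ∑ v ∈ antidiagonal m, appellKnotTerm α β γ δ x₁ x₂ (k, v)
      = ∑ v ∈ antidiagonal m, gaussTerm α β γ x₁ x₂ x₂ (k, v) *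
        (rising (γ + δ - α - 1) v.1 * rising (β + v.1) v.2 / rising δ (v.1 + v.2)) := by
  set C := x₁ ^ k * x₂ ^ m / (rising γ k * rising δ m * k ! * m !)
  calc ∑ v ∈ antidiagonal m, appellKnotTerm α β γ δ x₁ x₂ (k, v)
      = C * ∑ v ∈ antidiagonal m, m.choose v.1 * (k.descFactorial v.1 * (-1) ^ v.1 *
          (rising α (k + v.2) * rising β (k + v.2) *
            rising (γ + δ - α - 1 + (α + ↑(k + v.2))) v.1)) := by
        rw [Finset.mul_sum]
        refine Finset.sum_congr rfl fun v hv => ?_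
        obtain rfl := mem_antidiagonal.1 hv
        exact appellKnotTerm_eq_mul x₁ x₂ hγ hδ k v.1 v.2
    _ = _ := by
        rw [appell_identity, Finset.mul_sum]
        refine Finset.sum_congr rfl fun v hv => ?_
        obtain rfl := mem_antidiagonal.1 hv
        exact (gaussTerm_mul_eq_mul x₁ x₂ hγ hδ k v.1 v.2).symm

lemma doubleAverage_knots_eq_tsum {α β γ δ x₁ x₂ : ℝ} {d : Fin 3 → ℝ} (hd : ∀ i, 0 < d i)
    (hd0 : d 0 = γ + δ - α - 1) (hd01 : d 0 + d 1 = β) (hd012 : d 0 + d 1 + d 2 = δ)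
    (hγ : ∀ m : ℕ, γ ≠ -m) (h : √(|x₁| * (1 + |x₂|)) + √(|x₂| * (1 + |x₁|)) < 1) :
    doubleAverage α ![β, γ - β] d (knots x₁ x₂)
      = ∑' p, appellF4Term α β γ δ (x₁ * (1 - x₂)) (x₂ * (1 - x₁)) p := by
  have hδ (m : ℕ) : δ ≠ -m := by
    linarith [hd 0, hd 1, hd 2, (m.cast_nonneg : (0 : ℝ) ≤ m)]
  have haverage := hasSum_sum_antidiagonal
    (hasSum_doubleAverage_knots α β hγ (abs_mul_add_abs_lt_one h) hd)
  simp_rw [hd012, hd01, hd0] at haverage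
  refine haverage.unique ?_
  simpa only [sum_appellKnotTerm x₁ x₂ hγ hδ] using
    hasSum_sum_antidiagonal (hasSum_appellKnotTerm α β hγ hδ h)

lemma knots_pos {x : ℝ × ℝ} (hx : x ∈ regionΛ) (i : Fin 2) (j : Fin 3) : 0 < knots x.1 x.2 i j := by
  obtain ⟨h1, h2, h3⟩ := hx
  have h₁ : 0 < 1 - x.1 := sub_pos.2 h1
  have h₂ : 0 < 1 - x.2 := sub_pos.2 h2
  have h₃ : 0 < 1 - x.1 - x.2 := by linarith
  fin_cases i <;> fin_cases j
  exacts [mul_pos h₁ h₂, h₃, h₁, h₂, h₂, one_pos]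

lemma analyticAt_doubleAverage_knots (a : ℝ) {b : Fin 2 → ℝ} (hb : ∀ m : ℕ, b 0 + b 1 ≠ -m)
    {d : Fin 3 → ℝ} (hd : ∀ i, 0 < d i) {x : ℝ × ℝ} (hx : x ∈ regionΛ) :
    AnalyticAt ℝ (fun x => doubleAverage a b d (knots x.1 x.2)) x := by
  let Z : ℂ × ℂ → Fin 2 → Fin 3 → ℂ := fun p =>
    !![(1 - p.1) * (1 - p.2), 1 - p.1 - p.2, 1 - p.1; 1 - p.2, 1 - p.2, 1]
  refine analyticAt_doubleAverage a hb hd (Z := Z) (fun p i j => ?_) (fun x i j => ?_)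
    (knots_pos hx)
  · have h₁ : AnalyticAt ℂ (fun p : ℂ × ℂ => 1 - p.1) p := analyticAt_const.fun_sub analyticAt_fst
    have h₂ : AnalyticAt ℂ (fun p : ℂ × ℂ => 1 - p.2) p := analyticAt_const.fun_sub analyticAt_snd
    fin_cases i <;> fin_cases j
    exacts [h₁.fun_mul h₂, h₁.fun_sub analyticAt_snd, h₁, h₂, h₂, analyticAt_const]
  · fin_cases i <;> fin_cases j <;> simp [Z, knots]

end KnotExpansion

section AppellContinuation

/-- The domain of convergence of the double power series of `F_4`. -/
def appellDisc : Set (ℝ × ℝ) := {p | √|p.1| + √|p.2| < 1}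

lemma zero_mem_appellDisc : (0, 0) ∈ appellDisc := by simp [appellDisc]

lemma isOpen_appellDisc : IsOpen appellDisc :=
  isOpen_lt (by fun_prop : Continuous fun p : ℝ × ℝ => √|p.1| + √|p.2|) continuous_const

lemma isPreconnected_appellDisc : IsPreconnected appellDisc := by
  have hstar : StarConvex ℝ (0, 0) appellDisc := by
    refine starConvex_zero_iff.2 fun p hp a ha0 ha1 => ?_
    refine lt_of_le_of_lt (?_ : √|(a • p).1| + √|(a • p).2| ≤ √|p.1| + √|p.2|) hp
    simp only [Prod.smul_fst, Prod.smul_snd, smul_eq_mul, abs_mul, abs_of_nonneg ha0]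
    gcongr <;> exact mul_le_of_le_one_left (abs_nonneg _) ha1
  exact (hstar.isPathConnected zero_mem_appellDisc).isConnected.isPreconnected

lemma exists_sqrt_add_sqrt_lt_one {X Y : ℝ} (h : √X + √Y < 1) :
    ∃ ε > 0, √(X + ε) + √(Y + ε) < 1 := by
  have hcont : Continuous fun ε : ℝ => √(X + ε) + √(Y + ε) := by fun_prop
  have hev : ∀ᶠ ε in 𝓝 0, √(X + ε) + √(Y + ε) < 1 :=
    (hcont.tendsto 0).eventually_lt_const (by simpa using h)
  have hpos : ∀ᶠ ε : ℝ in 𝓝[>] 0, 0 < ε := eventually_mem_nhdsWithin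
  exact (hpos.and (hev.filter_mono nhdsWithin_le_nhds)).exists

lemma analyticOnNhd_tsum_appellCoeff (α β : ℝ) {γ δ : ℝ} (hγ : ∀ m : ℕ, γ ≠ -m)
    (hδ : ∀ m : ℕ, δ ≠ -m) :
    AnalyticOnNhd ℂ (fun z : ℂ × ℂ =>
        ∑' p : ℕ × ℕ, (appellCoeff α β γ δ p.1 p.2 : ℂ) * (z.1 ^ p.1 * z.2 ^ p.2))
      {z | √‖z.1‖ + √‖z.2‖ < 1} := by
  refine analyticOnNhd_tsum (isOpen_lt (by fun_prop) continuous_const)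
    (fun p z _ => analyticAt_const.fun_mul
      ((analyticAt_fst.fun_pow p.1).fun_mul (analyticAt_snd.fun_pow p.2))) fun z hz => ?_
  obtain ⟨ε, hε, hlt⟩ := exists_sqrt_add_sqrt_lt_one hz
  have hV : {w : ℂ × ℂ | ‖w.1‖ < ‖z.1‖ + ε ∧ ‖w.2‖ < ‖z.2‖ + ε} ∈ 𝓝 z :=
    ((isOpen_lt (by fun_prop : Continuous fun w : ℂ × ℂ => ‖w.1‖) continuous_const).inter
      (isOpen_lt (by fun_prop : Continuous fun w : ℂ × ℂ => ‖w.2‖) continuous_const)).mem_nhds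
        ⟨lt_add_of_pos_right _ hε, lt_add_of_pos_right _ hε⟩
  refine ⟨_, hV, _, summable_abs_appellCoeff_mul_pow α β hγ hδ (by positivity) (by positivity) hlt,
    fun w hw p => ?_⟩
  rw [norm_mul, norm_mul, norm_pow, norm_pow, Complex.norm_real, Real.norm_eq_abs]
  gcongr
  exacts [hw.1.le, hw.2.le]

lemma analyticOnNhd_tsum_appellF4Term (α β : ℝ) {γ δ : ℝ} (hγ : ∀ m : ℕ, γ ≠ -m)
    (hδ : ∀ m : ℕ, δ ≠ -m) :
    AnalyticOnNhd ℝ (fun p => ∑' q, appellF4Term α β γ δ p.1 p.2 q) appellDisc := by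
  intro p hp
  let emb : ℝ × ℝ →L[ℝ] ℂ × ℂ := Complex.ofRealCLM.prodMap Complex.ofRealCLM
  have hmem : emb p ∈ {z : ℂ × ℂ | √‖z.1‖ + √‖z.2‖ < 1} := by
    simpa [emb, appellDisc] using hp
  have hcomplex := (analyticOnNhd_tsum_appellCoeff α β hγ hδ _ hmem).restrictScalars (𝕜 := ℝ)
  refine ((Complex.reCLM.analyticAt _).comp (hcomplex.comp (emb.analyticAt p))).congr
    (.of_forall fun q => ?_)
  simp only [Function.comp_def, emb, Complex.reCLM_apply, appellF4Term_eq]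
  rw [← Complex.ofReal_re (∑' r : ℕ × ℕ, _), Complex.ofReal_tsum]
  simp

lemma hasSum_appellF4Term (α β : ℝ) {γ δ : ℝ} (hγ : ∀ m : ℕ, γ ≠ -m)
    (hδ : ∀ m : ℕ, δ ≠ -m) {p : ℝ × ℝ} (hp : p ∈ appellDisc) :
    HasSum (appellF4Term α β γ δ p.1 p.2) (∑' q, appellF4Term α β γ δ p.1 p.2 q) := by
  refine (Summable.of_norm_bounded (summable_abs_appellCoeff_mul_pow α β hγ hδ (abs_nonneg p.1)
    (abs_nonneg p.2) hp) fun q => le_of_eq ?_).hasSum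
  simp only [appellF4Term_eq, norm_mul, norm_pow, Real.norm_eq_abs]

/-- The discriminant of the quadratic equation that inverts
`(x₁, x₂) ↦ (x₁ (1 - x₂), x₂ (1 - x₁))`. -/
def appellDiscr (p : ℝ × ℝ) : ℝ := (1 - p.1 - p.2) ^ 2 - 4 * p.1 * p.2

/-- The inverse of `(x₁, x₂) ↦ (x₁ (1 - x₂), x₂ (1 - x₁))` with values in `Λ`, the branch on which
the square root of the discriminant is `1 - x₁ - x₂`. -/
def appellInv (p : ℝ × ℝ) : ℝ × ℝ :=
  ((1 + p.1 - p.2 - √(appellDiscr p)) / 2, (1 - p.1 + p.2 - √(appellDiscr p)) / 2)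

lemma appellDiscr_apply (x : ℝ × ℝ) :
    appellDiscr (x.1 * (1 - x.2), x.2 * (1 - x.1)) = (1 - x.1 - x.2) ^ 2 := by
  rw [appellDiscr]
  ring

lemma appellInv_apply {x : ℝ × ℝ} (hx : x ∈ regionΛ) :
    appellInv (x.1 * (1 - x.2), x.2 * (1 - x.1)) = x := by
  have hnonneg : 0 ≤ 1 - x.1 - x.2 := by linarith [hx.2.2]
  rw [appellInv, appellDiscr_apply, Real.sqrt_sq hnonneg]
  ext <;> ring

lemma apply_appellInv {p : ℝ × ℝ} (hp : 0 ≤ appellDiscr p) :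
    ((appellInv p).1 * (1 - (appellInv p).2), (appellInv p).2 * (1 - (appellInv p).1)) = p := by
  have hsq := Real.sq_sqrt hp
  have hdiscr : appellDiscr p = (1 - p.1 - p.2) ^ 2 - 4 * p.1 * p.2 := rfl
  ext <;> simp only [appellInv] <;> linear_combination (-1 / 4) * hsq - 1 / 4 * hdiscr

lemma appellDiscr_pos_of_mem {p : ℝ × ℝ} (hp : p ∈ domainF4) : 0 < appellDiscr p := by
  obtain ⟨x, hx, rfl⟩ := hp
  have : 0 < 1 - x.1 - x.2 := by linarith [hx.2.2]
  rw [appellDiscr_apply]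
  positivity

lemma appellInv_mem_of_mem {p : ℝ × ℝ} (hp : p ∈ domainF4) : appellInv p ∈ regionΛ := by
  obtain ⟨x, hx, rfl⟩ := hp
  rwa [appellInv_apply hx]

-- With `a = √|X|` and `b = √|Y|`, the discriminant is at least `(1 - a² - b²)² - (2ab)²`.
lemma appellDisc_subset_domainF4 : appellDisc ⊆ domainF4 := by
  intro p hp
  have ha := Real.sq_sqrt (abs_nonneg p.1)
  have hb := Real.sq_sqrt (abs_nonneg p.2)
  have hab : √|p.1| + √|p.2| < 1 := hp
  have ha0 := Real.sqrt_nonneg |p.1|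
  have hb0 := Real.sqrt_nonneg |p.2|
  set a := √|p.1|
  set b := √|p.2|
  have hpos : 0 < 1 - a ^ 2 - b ^ 2 - 2 * (a * b) := by nlinarith
  have hlinear : 1 - a ^ 2 - b ^ 2 ≤ 1 - p.1 - p.2 := by
    linarith [le_abs_self p.1, le_abs_self p.2]
  have hprod : p.1 * p.2 ≤ (a * b) ^ 2 := by
    rw [mul_pow, ha, hb, ← abs_mul]
    exact le_abs_self _
  have hdiscr : 0 < appellDiscr p := by
    rw [appellDiscr]
    nlinarith [mul_nonneg ha0 hb0]
  have hsqrt := Real.sqrt_pos.2 hdiscr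
  refine ⟨appellInv p, ?_, apply_appellInv hdiscr.le⟩
  refine ⟨?_, ?_, ?_⟩ <;> simp only [appellInv] <;>
    linarith [neg_abs_le p.1, neg_abs_le p.2, le_abs_self p.1, le_abs_self p.2,
      mul_nonneg ha0 hb0]

lemma isPreconnected_domainF4 : IsPreconnected domainF4 := by
  have hconvex : Convex ℝ regionΛ :=
    (convex_halfSpace_lt (LinearMap.fst ℝ ℝ ℝ).isLinear 1).inter
      ((convex_halfSpace_lt (LinearMap.snd ℝ ℝ ℝ).isLinear 1).inter
        (convex_halfSpace_lt (LinearMap.fst ℝ ℝ ℝ + LinearMap.snd ℝ ℝ ℝ).isLinear 1))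
  exact hconvex.isPreconnected.image _ (by fun_prop)

lemma analyticAt_appellInv {p : ℝ × ℝ} (hp : 0 < appellDiscr p) : AnalyticAt ℝ appellInv p := by
  have hfst : AnalyticAt ℝ (fun p : ℝ × ℝ => p.1) p := analyticAt_fst
  have hsnd : AnalyticAt ℝ (fun p : ℝ × ℝ => p.2) p := analyticAt_snd
  have hone : AnalyticAt ℝ (fun _ : ℝ × ℝ => (1 : ℝ)) p := analyticAt_const
  have hdiscr : AnalyticAt ℝ appellDiscr p :=
    (((hone.sub hfst).sub hsnd).pow 2).sub ((analyticAt_const.mul hfst).mul hsnd)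
  have hsqrt : AnalyticAt ℝ (fun p => √(appellDiscr p)) p :=
    AnalyticAt.comp (g := Real.sqrt) (Real.contDiffAt_sqrt hp.ne').analyticAt hdiscr
  exact ((((hone.add hfst).sub hsnd).sub hsqrt).div analyticAt_const two_ne_zero).prod
    ((((hone.sub hfst).add hsnd).sub hsqrt).div analyticAt_const two_ne_zero)

lemma doubleAverage_knots_appellInv_eventuallyEq {α β γ δ : ℝ} {d : Fin 3 → ℝ}
    (hd : ∀ i, 0 < d i) (hd0 : d 0 = γ + δ - α - 1) (hd01 : d 0 + d 1 = β)
    (hd012 : d 0 + d 1 + d 2 = δ) (hγ : ∀ m : ℕ, γ ≠ -m) :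
    (fun p => doubleAverage α ![β, γ - β] d (knots (appellInv p).1 (appellInv p).2))
      =ᶠ[𝓝 (0, 0)] fun p => ∑' q, appellF4Term α β γ δ p.1 p.2 q := by
  have hinv0 : appellInv (0, 0) = (0, 0) := by simp [appellInv, appellDiscr]
  have hdiscr0 : 0 < appellDiscr (0, 0) := by simp [appellDiscr]
  have hinv : Tendsto appellInv (𝓝 (0, 0)) (𝓝 (0, 0)) := by
    simpa only [hinv0] using (analyticAt_appellInv hdiscr0).continuousAt.tendsto
  have hsmall : ∀ᶠ x : ℝ × ℝ in 𝓝 (0, 0),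
      √(|x.1| * (1 + |x.2|)) + √(|x.2| * (1 + |x.1|)) < 1 :=
    (by fun_prop : Continuous fun x : ℝ × ℝ =>
      √(|x.1| * (1 + |x.2|)) + √(|x.2| * (1 + |x.1|))).continuousAt.eventually_lt
        continuousAt_const (by simp)
  have hmem : ∀ᶠ p in 𝓝 ((0, 0) : ℝ × ℝ), p ∈ appellDisc :=
    isOpen_appellDisc.mem_nhds zero_mem_appellDisc
  filter_upwards [hinv.eventually hsmall, hmem] with p hx hp
  obtain ⟨hX, hY⟩ := Prod.mk.inj
    (apply_appellInv (appellDiscr_pos_of_mem (appellDisc_subset_domainF4 hp)).le)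
  rw [doubleAverage_knots_eq_tsum hd hd0 hd01 hd012 hγ hx, hX, hY]

theorem isAppellF4_doubleAverage {α β γ δ : ℝ} {d : Fin 3 → ℝ} (hd : ∀ i, 0 < d i)
    (hd0 : d 0 = γ + δ - α - 1) (hd01 : d 0 + d 1 = β) (hd012 : d 0 + d 1 + d 2 = δ)
    (hγ : ∀ m : ℕ, γ ≠ -m) :
    IsAppellF4 α β γ δ
      fun p => doubleAverage α ![β, γ - β] d (knots (appellInv p).1 (appellInv p).2) := by
  have hδ (m : ℕ) : δ ≠ -m := by
    linarith [hd 0, hd 1, hd 2, (m.cast_nonneg : (0 : ℝ) ≤ m)]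
  have hanalytic : AnalyticOnNhd ℝ (fun p =>
      doubleAverage α ![β, γ - β] d (knots (appellInv p).1 (appellInv p).2)) domainF4 :=
    fun p hp => AnalyticAt.comp
      (g := fun x : ℝ × ℝ => doubleAverage α ![β, γ - β] d (knots x.1 x.2))
      (analyticAt_doubleAverage_knots α (by simpa using hγ) hd (appellInv_mem_of_mem hp))
      (analyticAt_appellInv (appellDiscr_pos_of_mem hp))
  have hseries := (hanalytic.mono appellDisc_subset_domainF4).eqOn_of_preconnected_of_eventuallyEq
    (analyticOnNhd_tsum_appellF4Term α β hγ hδ) isPreconnected_appellDisc zero_mem_appellDisc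
    (doubleAverage_knots_appellInv_eventuallyEq hd hd0 hd01 hd012 hγ)
  refine ⟨hanalytic, fun X Y h => ?_⟩
  rw [hseries (x := (X, Y)) h]
  exact hasSum_appellF4Term α β hγ hδ (p := (X, Y)) h

lemma IsAppellF4.eqOn {α β γ δ : ℝ} {G H : ℝ × ℝ → ℝ} (hG : IsAppellF4 α β γ δ G)
    (hH : IsAppellF4 α β γ δ H) : Set.EqOn G H domainF4 := by
  have hev : ∀ᶠ p in 𝓝 ((0, 0) : ℝ × ℝ), p ∈ appellDisc :=
    isOpen_appellDisc.mem_nhds zero_mem_appellDisc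
  exact hG.1.eqOn_of_preconnected_of_eventuallyEq hH.1 isPreconnected_domainF4
    (appellDisc_subset_domainF4 zero_mem_appellDisc)
    (hev.mono fun p hp => (hG.2 p.1 p.2 hp).unique (hH.2 p.1 p.2 hp))

theorem appellF4_eq_doubleAverage {α β γ δ : ℝ} {d : Fin 3 → ℝ} (hd : ∀ i, 0 < d i)
    (hd0 : d 0 = γ + δ - α - 1) (hd01 : d 0 + d 1 = β) (hd012 : d 0 + d 1 + d 2 = δ)
    (hγ : ∀ m : ℕ, γ ≠ -m) {x₁ x₂ : ℝ} (hx : (x₁, x₂) ∈ regionΛ) :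
    appellF4 α β γ δ (x₁ * (1 - x₂)) (x₂ * (1 - x₁))
      = doubleAverage α ![β, γ - β] d (knots x₁ x₂) := by
  have hG := isAppellF4_doubleAverage hd hd0 hd01 hd012 hγ
  have hF4 : IsAppellF4 α β γ δ (Classical.epsilon (IsAppellF4 α β γ δ)) :=
    Classical.epsilon_spec ⟨_, hG⟩
  refine (hF4.eqOn hG (Set.mem_image_of_mem _ hx)).trans ?_
  simp only [appellInv_apply hx]

end AppellContinuation

section SimplexSpline

variable {s n : ℕ}

/-- The matrix of edge vectors `x^j - x⁰` of the simplex with vertices the columns of `X`. -/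
def edgeMatrix (X : Matrix (Fin s) (Fin (n + 1)) ℝ) : Matrix (Fin s) (Fin n) ℝ :=
  fun i j => X i j.succ - X i 0

lemma mulVec_bary (X : Matrix (Fin s) (Fin (n + 1)) ℝ) (t : Fin n → ℝ) :
    X *ᵥ bary t = (fun i => X i 0) + edgeMatrix X *ᵥ t := by
  ext i
  simp only [Matrix.mulVec, dotProduct, bary, edgeMatrix, Fin.sum_univ_succ, Fin.cons_zero,
    Fin.cons_succ, Pi.add_apply, sub_mul, Finset.sum_sub_distrib, Finset.mul_sum, mul_sub, mul_one]
  ring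

lemma image_mulVec_bary (X : Matrix (Fin s) (Fin (n + 1)) ℝ) (S : Set (Fin n → ℝ)) :
    (fun t => X *ᵥ bary t) '' S
      = ((fun i => X i 0) + ·) '' (Matrix.toLin' (edgeMatrix X) '' S) := by
  rw [Set.image_image]
  exact Set.image_congr fun t _ => mulVec_bary X t

lemma convex_simplexE (n : ℕ) : Convex ℝ (simplexE n) := by
  have hsum : Convex ℝ {t : Fin n → ℝ | ∑ j, t j ≤ 1} :=
    convex_halfSpace_le (IsLinearMap.mk (fun _ _ => Finset.sum_add_distrib)
      fun _ _ => (Finset.mul_sum _ _ _).symm) 1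
  exact (convex_Ici (0 : Fin n → ℝ)).inter hsum

lemma mulVec_bary_mem_hull (X : Matrix (Fin s) (Fin (n + 1)) ℝ) {t : Fin n → ℝ}
    (ht : t ∈ simplexE n) : X *ᵥ bary t ∈ hull X := by
  have hcomb : X *ᵥ bary t = ∑ j, bary t j • fun i => X i j := by
    ext i
    simp [Matrix.mulVec, dotProduct, mul_comm]
  rw [hcomb]
  exact (convex_convexHull ℝ _).sum_mem (fun j _ => bary_nonneg ht j) (sum_bary t)
    fun j _ => subset_convexHull ℝ _ (Set.mem_range_self j)

lemma hull_eq_image (X : Matrix (Fin s) (Fin (n + 1)) ℝ) :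
    hull X = (fun t => X *ᵥ bary t) '' simplexE n := by
  have hconvex : Convex ℝ ((fun t => X *ᵥ bary t) '' simplexE n) := by
    rw [image_mulVec_bary]
    exact ((convex_simplexE n).linear_image _).translate _
  refine Set.Subset.antisymm (convexHull_min ?_ hconvex)
    (Set.image_subset_iff.2 fun t ht => mulVec_bary_mem_hull X ht)
  rintro _ ⟨j, rfl⟩
  cases j using Fin.cases with
  | zero => exact ⟨0, ⟨fun _ => le_rfl, by simp⟩, by simp [mulVec_bary]⟩
  | succ k =>
    have hsingle : (0 : Fin n → ℝ) ≤ Pi.single k 1 := Pi.single_nonneg.2 zero_le_one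
    refine ⟨Pi.single k 1, ⟨fun j => hsingle j, by simp⟩, ?_⟩
    ext i
    simp [mulVec_bary, edgeMatrix]

lemma measurableSet_hull (X : Matrix (Fin s) (Fin (n + 1)) ℝ) : MeasurableSet (hull X) := by
  rw [hull_eq_image]
  exact ((isCompact_simplexE n).image (by fun_prop)).measurableSet

lemma det_edgeMatrix_ne_zero {X : Matrix (Fin s) (Fin (s + 1)) ℝ} (h : 0 < volume (hull X)) :
    (edgeMatrix X).det ≠ 0 := by
  refine fun hdet => h.ne' ?_
  rw [hull_eq_image, image_mulVec_bary, Set.image_add_left, measure_preimage_add,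
    Measure.addHaar_image_linearMap, LinearMap.det_toLin', hdet, abs_zero, ENNReal.ofReal_zero,
    zero_mul]

lemma injective_mulVec_bary {X : Matrix (Fin s) (Fin (s + 1)) ℝ} (hX : (edgeMatrix X).det ≠ 0) :
    Function.Injective fun t => X *ᵥ bary t := by
  intro t u h
  simp only [mulVec_bary] at h
  exact Matrix.mulVec_injective_of_isUnit
    ((Matrix.isUnit_iff_isUnit_det _).2 (isUnit_iff_ne_zero.2 hX)) (add_left_cancel h)

lemma hasFDerivAt_mulVec_bary (X : Matrix (Fin s) (Fin (n + 1)) ℝ) (t : Fin n → ℝ) :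
    HasFDerivAt (fun t => X *ᵥ bary t)
      (LinearMap.toContinuousLinearMap (Matrix.toLin' (edgeMatrix X))) t := by
  simp only [mulVec_bary]
  exact (LinearMap.toContinuousLinearMap (Matrix.toLin' (edgeMatrix X))).hasFDerivAt.const_add _

lemma integrableOn_hull_iff {X : Matrix (Fin s) (Fin (s + 1)) ℝ} (hX : (edgeMatrix X).det ≠ 0)
    (g : (Fin s → ℝ) → ℝ) :
    IntegrableOn g (hull X) ↔
      IntegrableOn (fun t => |(edgeMatrix X).det| * g (X *ᵥ bary t)) (simplexE s) := by
  rw [hull_eq_image, integrableOn_image_iff_integrableOn_abs_det_fderiv_smul volume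
    (measurableSet_simplexE s) (fun t _ => (hasFDerivAt_mulVec_bary X t).hasFDerivWithinAt)
    (injective_mulVec_bary hX).injOn]
  simp only [LinearMap.det_toContinuousLinearMap, LinearMap.det_toLin', smul_eq_mul]

lemma setIntegral_hull {X : Matrix (Fin s) (Fin (s + 1)) ℝ} (hX : (edgeMatrix X).det ≠ 0)
    (g : (Fin s → ℝ) → ℝ) :
    ∫ y in hull X, g y = ∫ t in simplexE s, |(edgeMatrix X).det| * g (X *ᵥ bary t) := by
  rw [hull_eq_image, integral_image_eq_integral_abs_det_fderiv_smul volume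
    (measurableSet_simplexE s) (fun t _ => (hasFDerivAt_mulVec_bary X t).hasFDerivWithinAt)
    (injective_mulVec_bary hX).injOn]
  simp only [LinearMap.det_toContinuousLinearMap, LinearMap.det_toLin', smul_eq_mul]

/-- An explicit version of the Dirichlet spline when the columns of `X` are the vertices of a
nondegenerate simplex: the Dirichlet density transported to that simplex. -/
def simplexSpline (d : Fin (s + 1) → ℝ) (X : Matrix (Fin s) (Fin (s + 1)) ℝ) :
    (Fin s → ℝ) → ℝ :=
  (hull X).indicator fun y =>
    |(edgeMatrix X).det|⁻¹ * dirichletDensity d ((edgeMatrix X)⁻¹ *ᵥ (y - fun i => X i 0))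

lemma simplexSpline_apply {X : Matrix (Fin s) (Fin (s + 1)) ℝ} (hX : (edgeMatrix X).det ≠ 0)
    (d : Fin (s + 1) → ℝ) {t : Fin s → ℝ} (ht : t ∈ simplexE s) :
    |(edgeMatrix X).det| * simplexSpline d X (X *ᵥ bary t) = dirichletDensity d t := by
  rw [simplexSpline, Set.indicator_of_mem (mulVec_bary_mem_hull X ht),
    mul_inv_cancel_left₀ (abs_ne_zero.2 hX), mulVec_bary, add_sub_cancel_left,
    Matrix.mulVec_mulVec, Matrix.nonsing_inv_mul _ (isUnit_iff_ne_zero.2 hX), Matrix.one_mulVec]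

lemma integrableOn_hull_simplexSpline {X : Matrix (Fin s) (Fin (s + 1)) ℝ}
    (hX : (edgeMatrix X).det ≠ 0) {d : Fin (s + 1) → ℝ} {g : (Fin s → ℝ) → ℝ}
    (hg : IntegrableOn (fun t => g (X *ᵥ bary t) * dirichletDensity d t) (simplexE s)) :
    IntegrableOn (fun y => g y * simplexSpline d X y) (hull X) := by
  rw [integrableOn_hull_iff hX]
  refine hg.congr_fun (fun t ht => ?_) (measurableSet_simplexE s)
  simp only [← simplexSpline_apply hX d ht, mul_left_comm]

lemma setIntegral_hull_simplexSpline {X : Matrix (Fin s) (Fin (s + 1)) ℝ}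
    (hX : (edgeMatrix X).det ≠ 0) (d : Fin (s + 1) → ℝ) (g : (Fin s → ℝ) → ℝ) :
    ∫ y in hull X, g y * simplexSpline d X y
      = ∫ t in simplexE s, g (X *ᵥ bary t) * dirichletDensity d t := by
  rw [setIntegral_hull hX]
  refine setIntegral_congr_fun (measurableSet_simplexE s) fun t ht => ?_
  simp only [← simplexSpline_apply hX d ht, mul_left_comm]

lemma isDirichletSpline_simplexSpline {X : Matrix (Fin s) (Fin (s + 1)) ℝ}
    (hX : (edgeMatrix X).det ≠ 0) {d : Fin (s + 1) → ℝ} (hd : ∀ i, 0 < d i) :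
    IsDirichletSpline d X (simplexSpline d X) := by
  constructor
  · have hint := integrableOn_hull_simplexSpline (d := d) (g := fun _ => 1) hX
      (by simpa only [one_mul] using integrableOn_dirichletDensity hd)
    simp only [one_mul, simplexSpline, integrableOn_indicator_iff (measurableSet_hull X),
      Set.inter_self] at hint
    exact (hint.integrable_indicator (measurableSet_hull X)).locallyIntegrable
  · intro f _ _
    rw [← setIntegral_hull_simplexSpline hX, setIntegral_eq_integral_of_forall_compl_eq_zero]
    intro y hy
    rw [simplexSpline, Set.indicator_of_notMem hy, mul_zero]

lemma spline_ae_eq {X : Matrix (Fin s) (Fin (s + 1)) ℝ} (hX : (edgeMatrix X).det ≠ 0)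
    {d : Fin (s + 1) → ℝ} (hd : ∀ i, 0 < d i) : spline d X =ᵐ[volume] simplexSpline d X := by
  have hsimplex := isDirichletSpline_simplexSpline hX hd
  have hspline : IsDirichletSpline d X (spline d X) := Classical.epsilon_spec ⟨_, hsimplex⟩
  refine ae_eq_of_integral_contDiff_smul_eq hspline.1 hsimplex.1 fun g hg hgc => ?_
  simp only [smul_eq_mul, hspline.2 g hg.continuous hgc, hsimplex.2 g hg.continuous hgc]

end SimplexSpline

section Corollary

lemma pos_of_mem_hull {s n : ℕ} {X : Matrix (Fin s) (Fin (n + 1)) ℝ} (hX : ∀ i j, 0 < X i j)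
    {y : Fin s → ℝ} (hy : y ∈ hull X) (i : Fin s) : 0 < y i := by
  have hconvex : Convex ℝ {y : Fin s → ℝ | 0 < y i} :=
    convex_halfSpace_gt (IsLinearMap.mk (fun _ _ => rfl) fun _ _ => rfl) 0
  have hcols : Set.range (fun j i => X i j) ⊆ {y | 0 < y i} := Set.range_subset_iff.2 (hX i)
  exact convexHull_min hcols hconvex hy

lemma integral_hull_spline_mul_hyperR {X : Matrix (Fin 2) (Fin 3) ℝ} (hX : ∀ i j, 0 < X i j)
    (hvol : 0 < volume (hull X)) (a : ℝ) {b : Fin 2 → ℝ} (hb : ∀ m : ℕ, b 0 + b 1 ≠ -m)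
    {d : Fin 3 → ℝ} (hd : ∀ i, 0 < d i) :
    IntegrableOn (fun y => spline d X y * hyperR a b y) (hull X) ∧
      ∫ y in hull X, spline d X y * hyperR a b y = doubleAverage a b d X := by
  have hdet := det_edgeMatrix_ne_zero hvol
  have hae : (fun y => hyperR a b y * simplexSpline d X y)
      =ᵐ[volume.restrict (hull X)] fun y => spline d X y * hyperR a b y := by
    filter_upwards [ae_restrict_of_ae (spline_ae_eq hdet hd)] with y hy
    rw [hy, mul_comm]
  have hint := integrableOn_mul_dirichletDensity hd (continuousOn_hyperR_mulVec_bary a hb hX)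
  exact ⟨(integrableOn_hull_simplexSpline hdet hint).congr hae,
    (integral_congr_ae hae).symm.trans (setIntegral_hull_simplexSpline hdet d _)⟩

lemma momentIntegrand_ae_eq {X : Matrix (Fin 2) (Fin 3) ℝ} (hX : ∀ i j, 0 < X i j)
    (hvol : 0 < volume (hull X)) {b : Fin 2 → ℝ} (hb : ∀ m : ℕ, b 0 + b 1 ≠ -m)
    {d : Fin 3 → ℝ} (hd : ∀ i, 0 < d i) :
    momentIntegrand (-b) d X =ᵐ[volume]
      (hull X).indicator fun y => spline d X y * hyperR (b 0 + b 1) b y := by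
  filter_upwards [spline_ae_eq (det_edgeMatrix_ne_zero hvol) hd] with y hy
  by_cases hmem : y ∈ hull X
  · rw [Set.indicator_of_mem hmem, momentIntegrand, Fin.prod_univ_two,
      hyperR_self hb (pos_of_mem_hull hX hmem), mul_comm]
    rfl
  · rw [Set.indicator_of_notMem hmem, momentIntegrand, hy, simplexSpline,
      Set.indicator_of_notMem hmem, mul_zero]

lemma moment_neg_eq_doubleAverage {X : Matrix (Fin 2) (Fin 3) ℝ} (hX : ∀ i j, 0 < X i j)
    (hvol : 0 < volume (hull X)) {b : Fin 2 → ℝ} (hb : ∀ m : ℕ, b 0 + b 1 ≠ -m)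
    {d : Fin 3 → ℝ} (hd : ∀ i, 0 < d i) :
    Integrable (momentIntegrand (-b) d X) ∧
      moment (-b) d X = doubleAverage (b 0 + b 1) b d X := by
  obtain ⟨hint, heq⟩ := integral_hull_spline_mul_hyperR hX hvol (b 0 + b 1) hb hd
  have hae := momentIntegrand_ae_eq hX hvol hb hd
  refine ⟨(hint.integrable_indicator (measurableSet_hull X)).congr hae.symm, ?_⟩
  rw [moment, integral_congr_ae hae, integral_indicator (measurableSet_hull X), heq]

end Corollary

end DirichletSpline

end

open DirichletSpline in
theorem corollary6p3 (x₁ x₂ : ℝ) (hx : (x₁, x₂) ∈ regionΛ)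
    (hvol : 0 < volume (hull (knots x₁ x₂))) :
    (∀ (α β γ δ : ℝ) (d : Fin 3 → ℝ) (b : Fin 2 → ℝ),
      (∀ m : ℕ, γ ≠ -(m : ℝ)) →
      d = ![γ + δ - α - 1, α + β - γ - δ + 1, δ - β] →
      (∀ i, 0 < d i) →
      b = ![β, γ - β] →
      IntegrableOn (fun y => spline d (knots x₁ x₂) y * hyperR α b y) (hull (knots x₁ x₂)) ∧
      appellF4 α β γ δ (x₁ * (1 - x₂)) (x₂ * (1 - x₁)) =
        ∫ y in hull (knots x₁ x₂), spline d (knots x₁ x₂) y * hyperR α b y) ∧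
    (∀ (α β δ : ℝ) (d : Fin 3 → ℝ) (b : Fin 2 → ℝ),
      (∀ m : ℕ, α ≠ -(m : ℝ)) →
      d = ![δ - 1, β - δ + 1, δ - β] →
      (∀ i, 0 < d i) →
      b = ![β, α - β] →
      Integrable (momentIntegrand (-b) d (knots x₁ x₂)) ∧
      appellF4 α β α δ (x₁ * (1 - x₂)) (x₂ * (1 - x₁)) = moment (-b) d (knots x₁ x₂)) := by
  have hX := knots_pos hx
  refine ⟨fun α β γ δ d b hγ hdef hd hb => ?_, fun α β δ d b hα hdef hd hb => ?_⟩
  · have hF4 := appellF4_eq_doubleAverage (α := α) (β := β) (δ := δ) hd (by simp [hdef])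
      (by simp only [hdef, Matrix.cons_val]; ring)
      (by simp only [hdef, Matrix.cons_val]; ring) hγ hx
    obtain ⟨hint, heq⟩ := integral_hull_spline_mul_hyperR hX hvol α (b := b) (by simpa [hb]) hd
    exact ⟨hint, by rw [hF4, heq, hb]⟩
  · have hF4 := appellF4_eq_doubleAverage (α := α) (β := β) (δ := δ) hd (by simp [hdef])
      (by simp [hdef]) (by simp [hdef]) hα hx
    have hsum : b 0 + b 1 = α := by simp [hb]
    obtain ⟨hint, heq⟩ := moment_neg_eq_doubleAverage hX hvol (b := b) (by rwa [hsum]) hd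
    exact ⟨hint, by rw [hF4, heq, hsum, hb]⟩
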